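/- All matrices are $3\times 3$ and vectors have three coordinates. For a symmetric integral matrix $S$ put $S(x)=xSx^t$. For $R=\mathbb Z$, $R=\mathbb Z_p$ ($p$ prime) or $R=\mathbb R=\mathbb Z_\infty$, a vector $x\in R^3$ is primitive if its coordinates have no common divisor other than units of $R$. The $R$-orbits of primitive zeros of $S$ are the orbits of $\{A\in \mathrm{GL}_3(R): A^tSA=S\}$ on the primitive $x\in R^3$ with $S(x)=0$, where $A$ sends $x$ to $xA^t$. Let $c(S)$, $c_p(S)$ and $c_\infty(S)$ be the numbers of orbits for $R=\mathbb Z$, $\mathbb Z_p$ and $\mathbb R$. Integral matrices $S,S'$ are in the same class if $A^tSA=S'$ for some $A\in\mathrm{GL}_3(\mathbb Z)$, and in the same genus if this equation has a solution in $\mathrm{GL}_3(\mathbb Z_p)$ for every prime $p$ and in $\mathrm{GL}_3(\mathbb R)$. Suppose that $S$ is primitive (its entries have greatest common divisor $1$), isotropic (it has a primitive zero in $\mathbb Z^3$) and that $D=\det S>0$. Let $-\Omega>0$ be the greatest common divisor of the $2\times2$ minors of $S$, define the integer $\Delta>0$ by $D=\Omega^2\Delta$, and put $N=\gcd(\Omega,\Delta)$.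 Call $S$ special if, moreover, $N$, $\Omega/N$ and $\Delta/N$ are all square-free. Theorem. Let $S$ be special with $D$ odd, and let $G$ be its genus. Then $G$ consists of finitely many classes, $c(S')$ is finite for every $S'\in G$, each $c_p(S)$ is finite, $c_p(S)\neq 1$ for at most finitely many primes $p$, $c_\infty(S)=1$, and $$\sum_{S'\in G}c(S')=\prod_{p}c_p(S)=\prod_{p\mid N}\frac{p-1}{2},$$ where the sum runs over the classes $S'$ in $G$, the first product over all primes $p$ (including or omitting $p=\infty$ makes no difference), and the last product over the primes $p$ dividing $N$. -/

import Mathlib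

open scoped Matrix

namespace TernaryForm

section General

variable {R : Type*} [CommRing R]

/-- The value `S(x) = x S xᵗ` of the ternary quadratic form with matrix `S`. -/
def value (S : Matrix (Fin 3) (Fin 3) R) (x : Fin 3 → R) : R :=
  x ⬝ᵥ (S *ᵥ x)

/-- A vector is primitive if its only common divisors are units.  Over `ℤ` this says that the
gcd of the coordinates is `1`, over `ℤ_[p]` that some coordinate is a unit, over `ℝ` that the
vector is nonzero. -/
def IsPrimitiveVec (x : Fin 3 → R) : Prop :=
  ∀ d : R, (∀ i, d ∣ x i) → IsUnit d

/-- The set `𝒞(S)` of primitive zeros of `S` over `R`. -/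
def primitiveZeros (S : Matrix (Fin 3) (Fin 3) R) : Set (Fin 3 → R) :=
  {x | IsPrimitiveVec x ∧ value S x = 0}

/-- `S` and `S'` are equivalent over `R`: there is `A ∈ GL₃(R)` with `Aᵗ S A = S'`. -/
def Equivalent (S S' : Matrix (Fin 3) (Fin 3) R) : Prop :=
  ∃ A : GL (Fin 3) R, (A : Matrix (Fin 3) (Fin 3) R)ᵀ * S * (A : Matrix (Fin 3) (Fin 3) R) = S'

theorem Equivalent.refl (S : Matrix (Fin 3) (Fin 3) R) : Equivalent S S :=
  ⟨1, by simp⟩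

theorem conj_inv {S S' : Matrix (Fin 3) (Fin 3) R} {A : GL (Fin 3) R}
    (h : (A : Matrix (Fin 3) (Fin 3) R)ᵀ * S * (A : Matrix (Fin 3) (Fin 3) R) = S') :
    ((A⁻¹ : GL (Fin 3) R) : Matrix (Fin 3) (Fin 3) R)ᵀ * S' *
      ((A⁻¹ : GL (Fin 3) R) : Matrix (Fin 3) (Fin 3) R) = S := by
  have h1 : (A : Matrix (Fin 3) (Fin 3) R) * ((A⁻¹ : GL (Fin 3) R) : Matrix (Fin 3) (Fin 3) R)
      = 1 := A.mul_inv
  have h2 : ((A⁻¹ : GL (Fin 3) R) : Matrix (Fin 3) (Fin 3) R)ᵀ *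
      (A : Matrix (Fin 3) (Fin 3) R)ᵀ = 1 := by
    rw [← Matrix.transpose_mul, h1, Matrix.transpose_one]
  rw [← h]
  simp only [Matrix.mul_assoc]
  rw [h1, Matrix.mul_one, ← Matrix.mul_assoc, h2, Matrix.one_mul]

theorem conj_mul {S S' S'' : Matrix (Fin 3) (Fin 3) R} {A B : GL (Fin 3) R}
    (h : (A : Matrix (Fin 3) (Fin 3) R)ᵀ * S * (A : Matrix (Fin 3) (Fin 3) R) = S')
    (h' : (B : Matrix (Fin 3) (Fin 3) R)ᵀ * S' * (B : Matrix (Fin 3) (Fin 3) R) = S'') :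
    ((A * B : GL (Fin 3) R) : Matrix (Fin 3) (Fin 3) R)ᵀ * S *
      ((A * B : GL (Fin 3) R) : Matrix (Fin 3) (Fin 3) R) = S'' := by
  rw [← h', ← h, Units.val_mul, Matrix.transpose_mul]
  simp only [Matrix.mul_assoc]

theorem Equivalent.symm {S S' : Matrix (Fin 3) (Fin 3) R} (h : Equivalent S S') :
    Equivalent S' S :=
  h.elim fun A hA => ⟨A⁻¹, conj_inv hA⟩

theorem Equivalent.trans {S S' S'' : Matrix (Fin 3) (Fin 3) R} (h : Equivalent S S')
    (h' : Equivalent S' S'') : Equivalent S S'' :=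
  h.elim fun A hA => h'.elim fun B hB => ⟨A * B, conj_mul hA hB⟩

/-- The group `O(S)` of automorphs of `S` over `R`. -/
def automorphs (S : Matrix (Fin 3) (Fin 3) R) : Subgroup (GL (Fin 3) R) where
  carrier := {A | (A : Matrix (Fin 3) (Fin 3) R)ᵀ * S * (A : Matrix (Fin 3) (Fin 3) R) = S}
  mul_mem' ha hb := conj_mul ha hb
  one_mem' := by simp
  inv_mem' ha := conj_inv ha

/-- Two primitive zeros lie in the same orbit if `x Aᵗ = x'` for an automorph `A` (vectors are
written here as columns). -/
def orbitSetoid (S : Matrix (Fin 3) (Fin 3) R) : Setoid (primitiveZeros S) where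
  r x x' := ∃ A ∈ automorphs S, (A : Matrix (Fin 3) (Fin 3) R) *ᵥ x.1 = x'.1
  iseqv :=
    { refl := fun x => ⟨1, (automorphs S).one_mem, by simp⟩
      symm := by
        rintro x y ⟨A, hA, h⟩
        refine ⟨A⁻¹, (automorphs S).inv_mem hA, ?_⟩
        rw [← h, Matrix.mulVec_mulVec, ← Units.val_mul, inv_mul_cancel]
        simp
      trans := by
        rintro x y z ⟨A, hA, h⟩ ⟨B, hB, h'⟩
        refine ⟨B * A, (automorphs S).mul_mem hB hA, ?_⟩
        rw [← h', ← h, Matrix.mulVec_mulVec, ← Units.val_mul] }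

/-- The set of `R`-orbits of primitive zeros of `S` over `R`. -/
abbrev ZeroOrbits (S : Matrix (Fin 3) (Fin 3) R) : Type _ :=
  Quotient (orbitSetoid S)

/-- The number of `R`-orbits of primitive zeros of `S` over `R`. -/
noncomputable def orbitCount (S : Matrix (Fin 3) (Fin 3) R) : ℕ :=
  Nat.card (ZeroOrbits S)

theorem mem_zeros {S S' : Matrix (Fin 3) (Fin 3) R} {A : GL (Fin 3) R}
    (h : (A : Matrix (Fin 3) (Fin 3) R)ᵀ * S * (A : Matrix (Fin 3) (Fin 3) R) = S')
    {x : Fin 3 → R} (hx : x ∈ primitiveZeros S') :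
    (A : Matrix (Fin 3) (Fin 3) R) *ᵥ x ∈ primitiveZeros S := by
  refine ⟨fun d hd => hx.1 d fun i => ?_, ?_⟩
  · have h1 : x = ((A⁻¹ : GL (Fin 3) R) : Matrix (Fin 3) (Fin 3) R) *ᵥ
        ((A : Matrix (Fin 3) (Fin 3) R) *ᵥ x) := by
      rw [Matrix.mulVec_mulVec, ← Units.val_mul, inv_mul_cancel]
      simp
    rw [h1]
    simp only [Matrix.mulVec, dotProduct]
    exact Finset.dvd_sum fun j _ => Dvd.dvd.mul_left (hd j) _
  · have h2 := hx.2
    unfold value at h2 ⊢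
    rw [← h2, ← h, ← Matrix.mulVec_mulVec, ← Matrix.mulVec_mulVec,
      Matrix.dotProduct_mulVec x, Matrix.vecMul_transpose]

theorem rel_of_rel {S S' : Matrix (Fin 3) (Fin 3) R} {A : GL (Fin 3) R}
    (h : (A : Matrix (Fin 3) (Fin 3) R)ᵀ * S * (A : Matrix (Fin 3) (Fin 3) R) = S')
    {x y : Fin 3 → R} {B : GL (Fin 3) R} (hB : B ∈ automorphs S')
    (hxy : (B : Matrix (Fin 3) (Fin 3) R) *ᵥ x = y) :
    ∃ C ∈ automorphs S, (C : Matrix (Fin 3) (Fin 3) R) *ᵥ ((A : Matrix (Fin 3) (Fin 3) R) *ᵥ x) =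
      (A : Matrix (Fin 3) (Fin 3) R) *ᵥ y := by
  refine ⟨A * B * A⁻¹, conj_mul (conj_mul h hB) (conj_inv h), ?_⟩
  rw [← hxy, Matrix.mulVec_mulVec, Matrix.mulVec_mulVec, ← Units.val_mul, ← Units.val_mul,
    inv_mul_cancel_right]

theorem orbitCount_eq_of_equivalent {S S' : Matrix (Fin 3) (Fin 3) R} (h : Equivalent S S') :
    orbitCount S = orbitCount S' := by
  obtain ⟨A, hA⟩ := h
  have hA' := conj_inv hA
  have e1 : ∀ x : Fin 3 → R, (A : Matrix (Fin 3) (Fin 3) R) *ᵥ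
      (((A⁻¹ : GL (Fin 3) R) : Matrix (Fin 3) (Fin 3) R) *ᵥ x) = x := fun x => by
    rw [Matrix.mulVec_mulVec, ← Units.val_mul, mul_inv_cancel]
    simp
  have e2 : ∀ x : Fin 3 → R, ((A⁻¹ : GL (Fin 3) R) : Matrix (Fin 3) (Fin 3) R) *ᵥ
      ((A : Matrix (Fin 3) (Fin 3) R) *ᵥ x) = x := fun x => by
    rw [Matrix.mulVec_mulVec, ← Units.val_mul, inv_mul_cancel]
    simp
  let e : primitiveZeros S ≃ primitiveZeros S' :=
    { toFun := fun x => ⟨_, mem_zeros hA' x.2⟩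
      invFun := fun x => ⟨_, mem_zeros hA x.2⟩
      left_inv := fun x => Subtype.ext (e1 x.1)
      right_inv := fun x => Subtype.ext (e2 x.1) }
  refine Nat.card_congr (Quotient.congr e fun x y => ⟨?_, ?_⟩)
  · rintro ⟨B, hB, hxy⟩
    exact rel_of_rel hA' hB hxy
  · rintro ⟨B, hB, hxy⟩
    obtain ⟨C, hC, h⟩ := rel_of_rel hA hB hxy
    refine ⟨C, hC, ?_⟩
    have h3 : (C : Matrix (Fin 3) (Fin 3) R) *ᵥ ((A : Matrix (Fin 3) (Fin 3) R) *ᵥ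
        (((A⁻¹ : GL (Fin 3) R) : Matrix (Fin 3) (Fin 3) R) *ᵥ x.1)) =
        (A : Matrix (Fin 3) (Fin 3) R) *ᵥ
        (((A⁻¹ : GL (Fin 3) R) : Matrix (Fin 3) (Fin 3) R) *ᵥ y.1) := h
    rwa [e1, e1] at h3

end General

/-- The integral matrix `S` viewed over the ring `R`. -/
def baseChange (R : Type*) [CommRing R] (S : Matrix (Fin 3) (Fin 3) ℤ) : Matrix (Fin 3) (Fin 3) R :=
  S.map (Int.cast : ℤ → R)

instance fact_prime (p : Nat.Primes) : Fact (Nat.Prime (p : ℕ)) :=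
  ⟨p.2⟩

/-- `S` and `S'` are in the same genus: they are equivalent over `ℤ_[p]` for every prime `p`, and
over `ℝ`. -/
def SameGenus (S S' : Matrix (Fin 3) (Fin 3) ℤ) : Prop :=
  (∀ p : Nat.Primes, Equivalent (baseChange ℤ_[(p : ℕ)] S) (baseChange ℤ_[(p : ℕ)] S')) ∧
    Equivalent (baseChange ℝ S) (baseChange ℝ S')

/-- The genus of `S`, as a set of integral matrices. -/
def genus (S : Matrix (Fin 3) (Fin 3) ℤ) : Set (Matrix (Fin 3) (Fin 3) ℤ) :=
  {S' | SameGenus S S'}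

/-- Equivalence over `ℤ` on the genus of `S`. -/
def classSetoid (S : Matrix (Fin 3) (Fin 3) ℤ) : Setoid (genus S) where
  r S' S'' := Equivalent S'.1 S''.1
  iseqv :=
    { refl := fun _ => Equivalent.refl _
      symm := fun h => h.symm
      trans := fun h h' => h.trans h' }

/-- The set of classes in the genus of `S`. -/
abbrev GenusClasses (S : Matrix (Fin 3) (Fin 3) ℤ) : Type :=
  Quotient (classSetoid S)

/-- The number `c(S')` of `ℤ`-orbits of primitive zeros, for a class of forms `S'`. -/
noncomputable def classOrbitCount {S : Matrix (Fin 3) (Fin 3) ℤ} : GenusClasses S → ℕ :=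
  Quotient.lift (fun S' : genus S => orbitCount S'.1) fun _ _ h => orbitCount_eq_of_equivalent h

/-- The local orbit count `c_p(S)`. -/
noncomputable def localOrbitCount (S : Matrix (Fin 3) (Fin 3) ℤ) (p : Nat.Primes) : ℕ :=
  orbitCount (baseChange ℤ_[(p : ℕ)] S)

/-- The matrix `S` is primitive: its entries have no common divisor except `±1`. -/
def IsPrimitiveForm (S : Matrix (Fin 3) (Fin 3) ℤ) : Prop :=
  ∀ d : ℤ, (∀ i j, d ∣ S i j) → IsUnit d

/-- `S` is isotropic: it has a primitive integral zero. -/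
def IsIsotropic (S : Matrix (Fin 3) (Fin 3) ℤ) : Prop :=
  (primitiveZeros S).Nonempty

/-- The `2 × 2` minor of `S` obtained by deleting row `i` and column `j`. -/
def minor (S : Matrix (Fin 3) (Fin 3) ℤ) (i j : Fin 3) : ℤ :=
  (S.submatrix i.succAbove j.succAbove).det

/-- The (nonnegative) greatest common divisor of the nine `2 × 2` minors of `S`. -/
def minorGcd (S : Matrix (Fin 3) (Fin 3) ℤ) : ℕ :=
  Finset.univ.gcd fun ij : Fin 3 × Fin 3 => (minor S ij.1 ij.2).natAbs

/-- The invariant `Ω`, minus the gcd of the `2 × 2` minors. -/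
def Omega (S : Matrix (Fin 3) (Fin 3) ℤ) : ℤ :=
  -(minorGcd S : ℤ)

/-- The invariant `Δ`, given by `det S = Ω² Δ`; the division is exact when `S` is primitive, see
`det_eq`. -/
def Delta (S : Matrix (Fin 3) (Fin 3) ℤ) : ℤ :=
  S.det / Omega S ^ 2

theorem dvd_of_eq_gcd {ι : Type*} [Fintype ι] (f : ι → ℕ) (i : ι) (a b : ℕ)
    (ha : a = Finset.univ.gcd f) (hb : b = f i) : a ∣ b := by
  subst ha hb
  exact Finset.gcd_dvd (Finset.mem_univ i)

theorem minorGcd_dvd (S : Matrix (Fin 3) (Fin 3) ℤ) (i j : Fin 3) :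
    (minorGcd S : ℤ) ∣ S.adjugate i j := by
  have h1 : minorGcd S ∣ (minor S j i).natAbs :=
    dvd_of_eq_gcd (fun ij : Fin 3 × Fin 3 => (minor S ij.1 ij.2).natAbs) (j, i) _ _ rfl rfl
  have h2 : S.adjugate i j = (-1) ^ (j + i : ℕ) * minor S j i :=
    Matrix.adjugate_fin_succ_eq_det_submatrix S i j
  rw [h2]
  exact Dvd.dvd.mul_left (Int.natCast_dvd.2 h1) _

theorem det_eq {S : Matrix (Fin 3) (Fin 3) ℤ} (hS : IsPrimitiveForm S) :
    S.det = Omega S ^ 2 * Delta S := by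
  have hadj := minorGcd_dvd S
  generalize hG : (minorGcd S : ℤ) = G at hadj
  choose M hM using hadj
  have hM' : S.adjugate = G • Matrix.of M := by
    ext i j
    simp [hM]
  have h2 : S.det • S = (G ^ 2) • (Matrix.of M).adjugate := by
    have h3 := Matrix.adjugate_adjugate S (by simp)
    rw [hM', Matrix.adjugate_smul] at h3
    simpa using h3.symm
  have h4 : ∀ i j, G ^ 2 ∣ S.det * S i j := fun i j =>
    ⟨(Matrix.of M).adjugate i j, by simpa using congrFun (congrFun h2 i) j⟩
  let g : ℤ := Finset.univ.gcd fun ij : Fin 3 × Fin 3 => S ij.1 ij.2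
  have hg : IsUnit g := hS g fun i j => Finset.gcd_dvd (Finset.mem_univ (i, j))
  have h5 : G ^ 2 ∣
      Finset.univ.gcd fun ij : Fin 3 × Fin 3 => S.det * S ij.1 ij.2 :=
    Finset.dvd_gcd fun ij _ => h4 ij.1 ij.2
  rw [Finset.gcd_mul_left] at h5
  have h6 : G ^ 2 ∣ S.det :=
    dvd_normalize_iff.1 ((hg.dvd_mul_right).1 h5)
  have h7 : Omega S ^ 2 ∣ S.det := by
    simpa [Omega, hG] using h6
  exact (Int.mul_ediv_cancel' h7).symm

/-- `N = gcd(Ω, Δ)`. -/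
def levelN (S : Matrix (Fin 3) (Fin 3) ℤ) : ℕ :=
  Int.gcd (Omega S) (Delta S)

/-- `S` is special: a symmetric, primitive, isotropic integral matrix with positive determinant
such that `N`, `Ω / N` and `Δ / N` are all square-free. -/
structure IsSpecial (S : Matrix (Fin 3) (Fin 3) ℤ) : Prop where
  symm : S.IsSymm
  primitive : IsPrimitiveForm S
  isotropic : IsIsotropic S
  det_pos : 0 < S.det
  squarefree_N : Squarefree (levelN S)
  squarefree_Omega_div : Squarefree (Omega S / (levelN S : ℤ))
  squarefree_Delta_div : Squarefree (Delta S / (levelN S : ℤ))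

end TernaryForm

/-! A primitive zero `x` can be completed to a basis whose second vector is orthogonal to `x`, which
turns `S` into `flagForm r s t u` with `r ^ 2 * s = -D`. For special `S` the elementary divisors at
each prime leave one possible `r` up to units and put `t` in the ideal `(r, s)`, so a further change
of basis makes `t = 0` (`HasType.flagForm_exponents`, `IsRigid.exists_framedBy`). With `r` and `s`
fixed and `r * s` odd, the residue of `u` modulo `r` is a complete invariant of the orbit of `x`.
Hence, over `ℤ` and over `ℤ_[p]` alike, orbits correspond to those residues `u` modulo `r` for which
`flagForm r s 0 u` is equivalent to the given form (`nonempty_zeroOrbits_equiv`).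

Everything becomes a count of residues. Over `ℤ_[p]` with `p ∣ N` the admissible `u` are the
products of one of them with the unit squares, which gives `(p - 1) / 2` residues; otherwise there
is one (`HasType.card_corner_residues`). The residues modulo `r` whose form lies in the genus of `S`
are, by the Chinese remainder theorem, the product of the local sets, the real condition being
automatic (`IsCorner.card_genusResidues`). The same residues are split according to the class of
their form, and the block of `S'` has `c(S')` elements (`IsCorner.finsum_classOrbitCount`).

Finiteness of the genus requires every class to meet these finitely many forms, that is, to be
isotropic. This is proved with Minkowski's convex body theorem in
`isIsotropic_of_locally_equivalent`. -/

namespace TernaryForm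

/-! ### Bases adapted to a primitive zero -/

section NormalForm

variable {R : Type*} [CommRing R]

/-- The Gram matrix of a lattice with respect to a basis whose first vector is isotropic and
orthogonal to the second one. -/
def flagForm (r s t u : R) : Matrix (Fin 3) (Fin 3) R :=
  !![0, 0, r; 0, s, t; r, t, u]

/-- `S` has Gram matrix `T` in some basis with first vector `x`. -/
def FramedBy (S : Matrix (Fin 3) (Fin 3) R) (x : Fin 3 → R) (T : Matrix (Fin 3) (Fin 3) R) :
    Prop :=
  ∃ A : Matrix (Fin 3) (Fin 3) R, IsUnit A.det ∧ A *ᵥ ![1, 0, 0] = x ∧ Aᵀ * S * A = T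

theorem equivalent_iff {S S' : Matrix (Fin 3) (Fin 3) R} :
    Equivalent S S' ↔ ∃ A : Matrix (Fin 3) (Fin 3) R, IsUnit A.det ∧ Aᵀ * S * A = S' := by
  constructor
  · rintro ⟨A, hA⟩
    exact ⟨A, (Matrix.isUnit_iff_isUnit_det _).1 A.isUnit, hA⟩
  · rintro ⟨A, hA, h⟩
    exact ⟨Matrix.GeneralLinearGroup.mk'' A hA, h⟩

theorem FramedBy.equivalent {S T : Matrix (Fin 3) (Fin 3) R} {x : Fin 3 → R}
    (h : FramedBy S x T) : Equivalent S T := by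
  obtain ⟨A, hA, -, h⟩ := h
  exact equivalent_iff.2 ⟨A, hA, h⟩

theorem FramedBy.trans {S T T' : Matrix (Fin 3) (Fin 3) R} {x : Fin 3 → R}
    (h : FramedBy S x T) (h' : FramedBy T ![1, 0, 0] T') : FramedBy S x T' := by
  obtain ⟨A, hA, hx, rfl⟩ := h
  obtain ⟨B, hB, hy, rfl⟩ := h'
  refine ⟨A * B, by rw [Matrix.det_mul]; exact hA.mul hB, ?_, ?_⟩
  · rw [← Matrix.mulVec_mulVec, hy, hx]
  · simp only [Matrix.transpose_mul, Matrix.mul_assoc]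

theorem FramedBy.of_equivalent {S T T' : Matrix (Fin 3) (Fin 3) R} {x : Fin 3 → R}
    {A : GL (Fin 3) R}
    (hA : (A : Matrix (Fin 3) (Fin 3) R)ᵀ * S * (A : Matrix (Fin 3) (Fin 3) R) = T)
    (h : FramedBy T x T') : FramedBy S ((A : Matrix (Fin 3) (Fin 3) R) *ᵥ x) T' := by
  obtain ⟨B, hB, rfl, rfl⟩ := h
  refine ⟨A * B, ?_, ?_, ?_⟩
  · rw [Matrix.det_mul]
    exact ((Matrix.isUnit_iff_isUnit_det _).1 A.isUnit).mul hB
  · rw [← Matrix.mulVec_mulVec]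
  · rw [← hA]
    simp only [Matrix.transpose_mul, Matrix.mul_assoc]

theorem FramedBy.exists_automorph {S T : Matrix (Fin 3) (Fin 3) R} {x y : Fin 3 → R}
    (hx : FramedBy S x T) (hy : FramedBy S y T) :
    ∃ A ∈ automorphs S, (A : Matrix (Fin 3) (Fin 3) R) *ᵥ x = y := by
  obtain ⟨A, hA, hAx, hAT⟩ := hx
  obtain ⟨B, hB, hBy, hBT⟩ := hy
  let A' := Matrix.GeneralLinearGroup.mk'' A hA
  let B' := Matrix.GeneralLinearGroup.mk'' B hB
  have hA' : (A' : Matrix (Fin 3) (Fin 3) R)ᵀ * S * (A' : Matrix (Fin 3) (Fin 3) R) = T := hAT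
  have hB' : (B' : Matrix (Fin 3) (Fin 3) R)ᵀ * S * (B' : Matrix (Fin 3) (Fin 3) R) = T := hBT
  refine ⟨B' * A'⁻¹, conj_mul hB' (conj_inv hA'), ?_⟩
  rw [← hAx, ← hBy, Matrix.mulVec_mulVec]
  change (((B' * A'⁻¹ : GL (Fin 3) R) : Matrix (Fin 3) (Fin 3) R) *
    (A' : Matrix (Fin 3) (Fin 3) R)) *ᵥ _ = (B' : Matrix (Fin 3) (Fin 3) R) *ᵥ _
  rw [← Units.val_mul, inv_mul_cancel_right]

theorem det_flagForm (r s t u : R) : (flagForm r s t u).det = -(r ^ 2 * s) := by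
  simp [flagForm, Matrix.det_fin_three]
  ring

theorem flagForm_zero_mem (r s t u : R) : ![1, 0, 0] ∈ primitiveZeros (flagForm r s t u) := by
  refine ⟨fun d hd => isUnit_of_dvd_one (by simpa using hd 0), ?_⟩
  simp [value, flagForm, Matrix.mulVec, dotProduct, Fin.sum_univ_three]

/-- The effect on `flagForm` of multiplying the basis vectors by scalars. -/
theorem flagForm_scale (r s t u a b c : R) (h : IsUnit (a * b * c)) :
    Equivalent (flagForm r s t u)
      (flagForm (a * c * r) (b ^ 2 * s) (b * c * t) (c ^ 2 * u)) := by
  refine equivalent_iff.2 ⟨!![a, 0, 0; 0, b, 0; 0, 0, c], ?_, ?_⟩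
  · simpa [Matrix.det_fin_three] using h
  · ext i j
    fin_cases i <;> fin_cases j <;>
      simp [flagForm, Matrix.mul_apply, Fin.sum_univ_three] <;> ring

theorem flagForm_framedBy_scale (r s t u b c : R) (h : IsUnit (b * c)) :
    FramedBy (flagForm r s t u) ![1, 0, 0]
      (flagForm (c * r) (b ^ 2 * s) (b * c * t) (c ^ 2 * u)) := by
  refine ⟨!![1, 0, 0; 0, b, 0; 0, 0, c], ?_, ?_, ?_⟩
  · simpa [Matrix.det_fin_three] using h
  · ext i
    fin_cases i <;> simp
  · ext i j
    fin_cases i <;> fin_cases j <;>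
      simp [flagForm, Matrix.mul_apply, Fin.sum_univ_three] <;> ring

theorem flagForm_framedBy_shear (r s t u k l m : R) :
    FramedBy (flagForm r s t u) ![1, 0, 0]
      (flagForm r s (t + l * s + k * r) (u + 2 * l * t + l ^ 2 * s + 2 * m * r)) := by
  refine ⟨!![1, k, m; 0, 1, l; 0, 0, 1], ?_, ?_, ?_⟩
  · simp [Matrix.det_fin_three]
  · ext i
    fin_cases i <;> simp
  · ext i j
    fin_cases i <;> fin_cases j <;>
      simp [flagForm, Matrix.mul_apply, Fin.sum_univ_three] <;> ring

/-- A shear with `l = c * r`, `k = -c * s` keeps the zero entry and changes `u` by `r * (c ^ 2 * (r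
* s) + 2 * m)`. As `r * s` is odd and `c ^ 2 ≡ c` modulo 2, a suitable `m` makes this `r * c`. The
hypothesis `h2` lets one proof serve `ℤ`, `ℤ_[p]` and `ℝ`. -/
theorem flagForm_framedBy_of_dvd (h2 : ∀ c : R, 2 ∣ c ^ 2 - c) {r s u u' : R}
    (hodd : ∃ q, r * s = 2 * q + 1) (h : r ∣ u' - u) :
    FramedBy (flagForm r s 0 u) ![1, 0, 0] (flagForm r s 0 u') := by
  obtain ⟨c, hc⟩ := h
  obtain ⟨q, hq⟩ := hodd
  obtain ⟨d, hd⟩ := h2 c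
  convert flagForm_framedBy_shear r s 0 u (-c * s) (c * r) (-d - c ^ 2 * q) using 2
  · ring
  · linear_combination hc - r * hd - c ^ 2 * r * hq

/-- Fixing the first basis vector forces the matrix to be upper triangular with diagonal `1, ±1, 1`.
Its entry equation at `(1, 2)` gives `r ∣ s * A 1 2`, so `u` moves only by multiples of `r`. -/
theorem dvd_of_flagForm_framedBy [IsDomain R] {r s u u' : R} (hr : r ≠ 0) (hs : s ≠ 0)
    (h : FramedBy (flagForm r s 0 u) ![1, 0, 0] (flagForm r s 0 u')) : r ∣ u' - u := by
  obtain ⟨A, -, hx, hA⟩ := h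
  have e : ∀ i j, (Aᵀ * flagForm r s 0 u * A) i j = flagForm r s 0 u' i j := fun i j => by rw [hA]
  have hx' : ∀ i, (A *ᵥ ![1, 0, 0]) i = ![1, 0, 0] i := fun i => by rw [hx]
  have a00 : A 0 0 = 1 := by
    simpa [Matrix.mulVec, dotProduct, Fin.sum_univ_three] using hx' 0
  have a10 : A 1 0 = 0 := by
    simpa [Matrix.mulVec, dotProduct, Fin.sum_univ_three] using hx' 1
  have a20 : A 2 0 = 0 := by
    simpa [Matrix.mulVec, dotProduct, Fin.sum_univ_three] using hx' 2
  have e01 := e 0 1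
  have e02 := e 0 2
  have e11 := e 1 1
  have e12 := e 1 2
  have e22 := e 2 2
  simp [flagForm, Matrix.mul_apply, Fin.sum_univ_three, a00, a10, a20] at e01 e02 e11 e12 e22
  have a21 : A 2 1 = 0 := e01.resolve_left hr
  have a22 : A 2 2 = 1 := mul_left_cancel₀ hr (by rw [e02, mul_one])
  simp only [a21, a22] at e11 e12 e22
  have e3 : A 1 1 * A 1 1 = 1 := by
    apply mul_left_cancel₀ hs
    linear_combination e11
  exact ⟨2 * A 0 2 - A 1 1 * A 0 1 * A 1 2, by
    linear_combination -e22 + A 1 1 * A 1 2 * e12 - s * A 1 2 ^ 2 * e3⟩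

section PID

variable [IsDomain R] [IsPrincipalIdealRing R]

theorem exists_eq_mul_and_bezout (b c : R) :
    ∃ g b' c' m n : R, b = g * b' ∧ c = g * c' ∧ b' * m + c' * n = 1 := by
  obtain ⟨g, hg⟩ := IsPrincipalIdealRing.principal (Ideal.span {b, c})
  change Ideal.span {b, c} = Ideal.span {g} at hg
  have hb : g ∣ b := by
    rw [← Ideal.mem_span_singleton]
    exact hg ▸ Ideal.subset_span (by simp)
  have hc : g ∣ c := by
    rw [← Ideal.mem_span_singleton]
    exact hg ▸ Ideal.subset_span (by simp)
  have hg' : g ∈ Ideal.span {b, c} := hg ▸ Ideal.mem_span_singleton_self g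
  obtain ⟨m, n, hmn⟩ := Ideal.mem_span_pair.1 hg'
  obtain ⟨b', rfl⟩ := hb
  obtain ⟨c', rfl⟩ := hc
  by_cases h0 : g = 0
  -- When `b = c = 0` the cofactors are free; the pair `(1, 0)` is coprime.
  · exact ⟨0, 1, 0, 1, 0, by simp [h0], by simp [h0], by simp⟩
  · refine ⟨g, b', c', m, n, rfl, rfl, mul_left_cancel₀ h0 ?_⟩
    linear_combination hmn

/-- Two nested Bezout identities, one for the last two coordinates and one for the first coordinate
and their gcd, supply the missing columns. -/
theorem IsPrimitiveVec.exists_det_eq_one {x : Fin 3 → R} (hx : IsPrimitiveVec x) :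
    ∃ A : Matrix (Fin 3) (Fin 3) R, A.det = 1 ∧ A *ᵥ ![1, 0, 0] = x := by
  obtain ⟨g, b, c, m, n, hb, hc, hbc⟩ := exists_eq_mul_and_bezout (x 1) (x 2)
  obtain ⟨h, a, d, k, l, ha, hd, had⟩ := exists_eq_mul_and_bezout (x 0) g
  have hu : IsUnit h := hx h fun i => by
    fin_cases i
    · exact ⟨_, ha⟩
    · exact ⟨d * b, by simp [hb, hd, mul_assoc]⟩
    · exact ⟨d * c, by simp [hc, hd, mul_assoc]⟩
  obtain ⟨h', hh⟩ := hu.exists_right_inv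
  refine ⟨!![x 0, -(h' * l), 0; x 1, h' * k * b, -n; x 2, h' * k * c, m], ?_, ?_⟩
  · rw [Matrix.det_fin_three]
    simp only [Matrix.of_apply, Matrix.cons_val', Matrix.cons_val_zero, Matrix.cons_val_one,
      Matrix.cons_val]
    rw [hb, hc, hd, ha]
    linear_combination (b * m + c * n) * h * h' * had + h * h' * hbc + hh
  · ext i
    fin_cases i <;> simp

theorem exists_framedBy_flagForm {S : Matrix (Fin 3) (Fin 3) R} (hS : S.IsSymm)
    {x : Fin 3 → R} (hx : x ∈ primitiveZeros S) :
    ∃ r s t u, r ^ 2 * s = -S.det ∧ FramedBy S x (flagForm r s t u) := by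
  obtain ⟨A, hA, hAx⟩ := hx.1.exists_det_eq_one
  set T := Aᵀ * S * A with hT
  have hsymm : T.IsSymm := by
    simp [hT, Matrix.IsSymm, Matrix.transpose_mul, Matrix.mul_assoc, hS.eq]
  have h00 : T 0 0 = 0 := by
    have h1 := hx.2
    rw [← hAx] at h1
    unfold value at h1
    rw [← h1, hT]
    simp [Matrix.mul_apply, Matrix.mulVec, dotProduct, Fin.sum_univ_three]
    ring
  have h10 := hsymm.apply 0 1
  have h20 := hsymm.apply 0 2
  have h21 := hsymm.apply 1 2
  obtain ⟨g, b, c, m, n, hb, hc, hbc⟩ := exists_eq_mul_and_bezout (T 0 1) (T 0 2)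
  have key : FramedBy S x (flagForm g (c ^ 2 * T 1 1 - 2 * b * c * T 1 2 + b ^ 2 * T 2 2)
      (c * m * T 1 1 + (c * n - b * m) * T 1 2 - b * n * T 2 2)
      (m ^ 2 * T 1 1 + 2 * m * n * T 1 2 + n ^ 2 * T 2 2)) := by
    refine FramedBy.trans (T := T) ⟨A, by simp [hA], hAx, rfl⟩
      -- Since `x` pairs with the old basis as `(0, g * b, g * c)`, the column `(0, c, -b)` is
      -- orthogonal to `x` and `(0, m, n)` pairs with it to `g`; hence `r = g`.
      ⟨!![1, 0, 0; 0, c, m; 0, -b, n], ?_, ?_, ?_⟩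
    · have : c * n + m * b = 1 := by linear_combination hbc
      simp [Matrix.det_fin_three, this]
    · ext i
      fin_cases i <;> simp
    · ext i j
      fin_cases i <;> fin_cases j <;>
        simp [flagForm, Matrix.mul_apply, Fin.sum_univ_three, h00, h10, h20, h21, hb, hc]
      · ring
      · linear_combination g * hbc
      · ring
      · ring
      · ring
      · linear_combination g * hbc
      · ring
      · ring
  refine ⟨_, _, _, _, ?_, key⟩
  have hdet : T.det = S.det := by simp [hT, hA]
  rw [← hdet, Matrix.det_fin_three, h00, h10, h20, h21, hb, hc]
  ring

end PID

end NormalForm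

/-! ### Orbits of primitive zeros as residues -/

section Orbits

variable {R : Type*} [CommRing R]

theorem FramedBy.flagForm_of_flagForm {S T T' : Matrix (Fin 3) (Fin 3) R} {x : Fin 3 → R}
    (h : FramedBy S x T) (h' : FramedBy S x T') : FramedBy T ![1, 0, 0] T' := by
  obtain ⟨A, hA, hx, rfl⟩ := h
  obtain ⟨B, hB, hy, rfl⟩ := h'
  have hAA : A * A⁻¹ = 1 := Matrix.mul_nonsing_inv A hA
  refine ⟨A⁻¹ * B, ?_, ?_, ?_⟩
  · rw [Matrix.det_mul]
    exact (Matrix.isUnit_nonsing_inv_det A hA).mul hB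
  · rw [← Matrix.mulVec_mulVec, hy, ← hx, Matrix.mulVec_mulVec, Matrix.nonsing_inv_mul A hA,
      Matrix.one_mulVec]
  · have h1 : (A⁻¹ * B)ᵀ * (Aᵀ * S * A) * (A⁻¹ * B) =
        (A * A⁻¹ * B)ᵀ * S * (A * A⁻¹ * B) := by
      simp only [Matrix.transpose_mul, Matrix.mul_assoc]
    rw [h1, hAA, Matrix.one_mul]

/-- Every Gram matrix of `S` in a basis adapted to a primitive zero has the same corner `r` up to
units, and its entry `t` can be cleared. -/
def IsRigid (S : Matrix (Fin 3) (Fin 3) R) (r : R) : Prop :=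
  ∀ r' s' t' u', Equivalent S (flagForm r' s' t' u') →
    Associated r r' ∧ ∃ a b, t' = a * r' + b * s'

/-- A shear clears `t`, and a unit scaling turns the corner into the prescribed `r`; the determinant
then forces the middle entry to be `s`. -/
theorem IsRigid.exists_framedBy [IsDomain R] [IsPrincipalIdealRing R]
    {S : Matrix (Fin 3) (Fin 3) R} {r s : R} (hrig : IsRigid S r) (hS : S.IsSymm)
    (hr : r ≠ 0) (hdet : r ^ 2 * s = -S.det) {x : Fin 3 → R} (hx : x ∈ primitiveZeros S) :
    ∃ u, FramedBy S x (flagForm r s 0 u) := by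
  obtain ⟨r', s', t', u', hdet', h⟩ := exists_framedBy_flagForm hS hx
  obtain ⟨⟨ε, rfl⟩, a, b, rfl⟩ := hrig _ _ _ _ h.equivalent
  have h1 := h.trans (flagForm_framedBy_shear _ _ _ _ (-a) (-b) 0)
  have h2 := h1.trans (flagForm_framedBy_scale _ _ _ _ (ε : R) ((ε⁻¹ : Rˣ) : R) (by simp))
  have hs : (ε : R) ^ 2 * s' = s := by
    apply mul_left_cancel₀ (pow_ne_zero 2 hr)
    linear_combination hdet' - hdet
  have hr' : ((ε⁻¹ : Rˣ) : R) * (r * (ε : R)) = r := by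
    rw [mul_left_comm, Units.inv_mul, mul_one]
  rw [hs, hr'] at h2
  ring_nf at h2
  exact ⟨_, h2⟩

/-- A zero goes to the residue of its `u`: this is well defined by `dvd_of_flagForm_framedBy` and
injective on orbits by `flagForm_framedBy_of_dvd`. It is onto because an equivalence with `flagForm
r s 0 u` carries `![1, 0, 0]` to a zero of `S`. The abstract `π` covers reduction to both `ZMod r`
and `ZMod (p ^ k)`. -/
theorem nonempty_zeroOrbits_equiv [IsDomain R] (h2 : ∀ c : R, 2 ∣ c ^ 2 - c)
    {S : Matrix (Fin 3) (Fin 3) R} {r s : R} (hr : r ≠ 0) (hs : s ≠ 0)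
    (hodd : ∃ q, r * s = 2 * q + 1) {Q : Type*} (π : R → Q)
    (hπ : ∀ u u', π u = π u' ↔ r ∣ u' - u)
    (hframe : ∀ x ∈ primitiveZeros S, ∃ u, FramedBy S x (flagForm r s 0 u)) :
    Nonempty (ZeroOrbits S ≃ {q : Q // ∃ u, π u = q ∧ Equivalent S (flagForm r s 0 u)}) := by
  choose f hf using hframe
  let g : primitiveZeros S → {q : Q // ∃ u, π u = q ∧ Equivalent S (flagForm r s 0 u)} :=
    fun x => ⟨π (f x x.2), f x x.2, rfl, (hf x x.2).equivalent⟩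
  have hg : ∀ (x : primitiveZeros S) (u : R), FramedBy S x (flagForm r s 0 u) →
      (g x : Q) = π u := fun x u hu =>
    (hπ _ _).2 (dvd_of_flagForm_framedBy hr hs ((hf x x.2).flagForm_of_flagForm hu))
  refine ⟨Equiv.ofBijective (Quotient.lift g ?_) ⟨?_, ?_⟩⟩
  · rintro x y ⟨A, hA, hxy⟩
    refine Subtype.ext (hg y _ ?_).symm
    have := (hf x x.2).of_equivalent (S := S) hA
    rwa [hxy] at this
  · rintro ⟨x⟩ ⟨y⟩ hxy
    have h1 : π (f x x.2) = π (f y y.2) := congrArg Subtype.val hxy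
    rw [hπ] at h1
    exact Quotient.sound (((hf x x.2).trans
      (flagForm_framedBy_of_dvd h2 hodd h1)).exists_automorph (hf y y.2))
  · rintro ⟨q, u, rfl, A, hA⟩
    have h0 := mem_zeros hA (flagForm_zero_mem r s 0 u)
    refine ⟨Quotient.mk _ ⟨_, h0⟩, Subtype.ext (hg ⟨_, h0⟩ u ?_)⟩
    exact ⟨A, (Matrix.isUnit_iff_isUnit_det _).1 A.isUnit, rfl, hA⟩

theorem Equivalent.isRigid {S S' : Matrix (Fin 3) (Fin 3) R} {r : R} (h : Equivalent S S')
    (hS : IsRigid S r) : IsRigid S' r :=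
  fun _ _ _ _ h' => hS _ _ _ _ (h.trans h')

theorem Equivalent.isSymm {S S' : Matrix (Fin 3) (Fin 3) R} (h : Equivalent S S')
    (hS : S.IsSymm) : S'.IsSymm := by
  obtain ⟨A, rfl⟩ := h
  simp [Matrix.IsSymm, Matrix.transpose_mul, Matrix.mul_assoc, hS.eq]

theorem Equivalent.exists_det_eq {S S' : Matrix (Fin 3) (Fin 3) R} (h : Equivalent S S') :
    ∃ ε : Rˣ, S'.det = ε ^ 2 * S.det := by
  obtain ⟨A, hA, rfl⟩ := equivalent_iff.1 h
  obtain ⟨ε, hε⟩ := hA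
  exact ⟨ε, by simp [← hε]; ring⟩

theorem Equivalent.dvd_apply {S S' : Matrix (Fin 3) (Fin 3) R} (h : Equivalent S S') {d : R}
    (hd : ∀ i j, d ∣ S i j) (i j : Fin 3) : d ∣ S' i j := by
  obtain ⟨A, rfl⟩ := h
  simp only [Matrix.mul_apply]
  exact Finset.dvd_sum fun k _ => Dvd.dvd.mul_right
    (Finset.dvd_sum fun l _ => Dvd.dvd.mul_left (hd _ _) _) _

theorem Equivalent.dvd_adjugate_apply {S S' : Matrix (Fin 3) (Fin 3) R} (h : Equivalent S S')
    {d : R} (hd : ∀ i j, d ∣ S.adjugate i j) (i j : Fin 3) : d ∣ S'.adjugate i j := by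
  obtain ⟨A, rfl⟩ := h
  simp only [Matrix.adjugate_mul_distrib, ← Matrix.mul_assoc]
  rw [Matrix.mul_assoc]
  simp only [Matrix.mul_apply]
  exact Finset.dvd_sum fun k _ => Dvd.dvd.mul_left
    (Finset.dvd_sum fun l _ => Dvd.dvd.mul_right (hd _ _) _) _

theorem baseChange_flagForm (r s t u : ℤ) :
    baseChange R (flagForm r s t u) = flagForm (r : R) s t u := by
  ext i j
  fin_cases i <;> fin_cases j <;> simp [baseChange, flagForm]

theorem Equivalent.baseChange {S S' : Matrix (Fin 3) (Fin 3) ℤ} (h : Equivalent S S') :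
    Equivalent (baseChange R S) (baseChange R S') := by
  obtain ⟨A, hA, rfl⟩ := equivalent_iff.1 h
  refine equivalent_iff.2 ⟨A.map (Int.castRingHom R), ?_, ?_⟩
  · rw [← RingHom.mapMatrix_apply, ← RingHom.map_det]
    exact hA.map _
  · change _ * S.map (Int.castRingHom R) * _ = (_ * S * A).map (Int.castRingHom R)
    rw [Matrix.map_mul, Matrix.map_mul, Matrix.transpose_map]

theorem det_baseChange (S : Matrix (Fin 3) (Fin 3) ℤ) :
    (baseChange R S).det = (S.det : R) :=
  ((Int.castRingHom R).map_det S).symm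

theorem adjugate_baseChange (S : Matrix (Fin 3) (Fin 3) ℤ) :
    (baseChange R S).adjugate = baseChange R S.adjugate :=
  ((Int.castRingHom R).map_adjugate S).symm

theorem IsSymm.baseChange {S : Matrix (Fin 3) (Fin 3) ℤ} (h : S.IsSymm) :
    (baseChange R S).IsSymm :=
  Matrix.IsSymm.map h _

end Orbits

/-! ### Elementary divisors and equivalence over the `p`-adic integers -/

section Local

variable {p : ℕ} [Fact p.Prime]

theorem padicInt_isUnit_iff_not_dvd {x : ℤ_[p]} : IsUnit x ↔ ¬ (p : ℤ_[p]) ∣ x := by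
  rw [← PadicInt.norm_lt_one_iff_dvd, not_lt, PadicInt.isUnit_iff]
  exact ⟨fun h => h.ge, fun h => le_antisymm (PadicInt.norm_le_one x) h⟩

theorem padicInt_pow_dvd_pow_mul_unit {k n : ℕ} (ε : ℤ_[p]ˣ) :
    (p : ℤ_[p]) ^ k ∣ (p : ℤ_[p]) ^ n * ε ↔ k ≤ n := by
  rw [Units.dvd_mul_right, pow_dvd_pow_iff PadicInt.prime_p.ne_zero PadicInt.prime_p.not_isUnit]

theorem padicInt_exists_eq_pow_mul_unit {x : ℤ_[p]} (hx : x ≠ 0) :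
    ∃ (n : ℕ) (ε : ℤ_[p]ˣ), x = (p : ℤ_[p]) ^ n * ε :=
  ⟨_, PadicInt.unitCoeff hx, by rw [mul_comm]; exact PadicInt.unitCoeff_spec hx⟩

theorem padicInt_two_dvd_sq_sub (c : ℤ_[p]) : 2 ∣ c ^ 2 - c := by
  by_cases h : p = 2
  · subst h
    obtain ⟨n, -, hn⟩ := PadicInt.exists_mem_range c
    have h1 : (2 : ℤ_[2]) ∣ c - n := by
      have h3 : ‖c - (n : ℤ_[2])‖ < 1 := PadicInt.mem_nonunits.1 hn
      rw [PadicInt.norm_lt_one_iff_dvd] at h3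
      exact_mod_cast h3
    have h2 : (2 : ℤ_[2]) ∣ (n : ℤ_[2]) ^ 2 - n := by
      have h4 : (2 : ℤ) ∣ (n : ℤ) ^ 2 - n := by
        have h5 : (n : ℤ) ^ 2 - n = n * (n - 1) := by ring
        rw [h5]
        exact (Int.even_mul_pred_self (n : ℤ)).two_dvd
      have := map_dvd (Int.castRingHom ℤ_[2]) h4
      simpa using this
    obtain ⟨d, hd⟩ := h1
    obtain ⟨d', hd'⟩ := h2
    exact ⟨d' + d * (c + n - 1), by linear_combination hd' + (c + n - 1) * hd⟩
  · refine IsUnit.dvd (padicInt_isUnit_iff_not_dvd.2 fun h' => h ?_)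
    have : (p : ℤ_[p]) ^ 1 ∣ ((2 : ℤ) : ℤ_[p]) := by simpa using h'
    rw [PadicInt.pow_p_dvd_int_iff] at this
    have h5 : p ∣ 2 := by
      rw [pow_one] at this
      exact_mod_cast this
    exact (Nat.prime_dvd_prime_iff_eq Fact.out Nat.prime_two).1 h5

/-- The elementary divisors of the `p`-adic matrix `M` are `1`, `p ^ i`, `p ^ (i + j)`. -/
structure HasType (i j : ℕ) (M : Matrix (Fin 3) (Fin 3) ℤ_[p]) : Prop where
  entries : ¬ ∀ a b, (p : ℤ_[p]) ∣ M a b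
  adjugate_dvd : ∀ a b, (p : ℤ_[p]) ^ i ∣ M.adjugate a b
  adjugate_not_dvd : ¬ ∀ a b, (p : ℤ_[p]) ^ (i + 1) ∣ M.adjugate a b
  det : ∃ ε : ℤ_[p]ˣ, M.det = (p : ℤ_[p]) ^ (2 * i + j) * ε

theorem HasType.of_equivalent {i j : ℕ} {M M' : Matrix (Fin 3) (Fin 3) ℤ_[p]}
    (h : HasType i j M) (hM : Equivalent M M') : HasType i j M' where
  entries h' := h.entries fun a b => hM.symm.dvd_apply h' a b
  adjugate_dvd := hM.dvd_adjugate_apply h.adjugate_dvd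
  adjugate_not_dvd h' := h.adjugate_not_dvd fun a b => hM.symm.dvd_adjugate_apply h' a b
  det := by
    obtain ⟨ε, hε⟩ := h.det
    obtain ⟨η, hη⟩ := hM.exists_det_eq
    exact ⟨η ^ 2 * ε, by rw [hη, hε]; push_cast; ring⟩

/-- The pairs of exponents that occur for special matrices. -/
def IsSpecialType (i j : ℕ) : Prop :=
  min i j ≤ 1 ∧ i - min i j ≤ 1 ∧ j - min i j ≤ 1

theorem IsSpecialType.cases {i j : ℕ} (h : IsSpecialType i j) :
    (i = 0 ∧ j = 0) ∨ (i = 0 ∧ j = 1) ∨ (i = 1 ∧ j = 0) ∨ (i = 1 ∧ j = 1) ∨ (i = 2 ∧ j = 1) ∨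
      (i = 1 ∧ j = 2) := by
  obtain ⟨h1, h2, h3⟩ := h
  omega

/-- The exponent of `p` in the corner entry of a `flagForm` of type `(i, j)`. -/
def cornerExp (i j : ℕ) : ℕ :=
  if i = 0 then 0 else if j = 2 then 2 else 1

theorem adjugate_flagForm {R : Type*} [CommRing R] (r s t u : R) :
    (flagForm r s t u).adjugate =
      !![s * u - t ^ 2, r * t, -(r * s); r * t, -r ^ 2, 0; -(r * s), 0, 0] := by
  rw [Matrix.adjugate_fin_three]
  ext i j
  fin_cases i <;> fin_cases j <;> simp [flagForm] <;> ring

theorem dvd_flagForm_iff {R : Type*} [CommRing R] (d r s t u : R) :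
    (∀ a b, d ∣ flagForm r s t u a b) ↔ d ∣ r ∧ d ∣ s ∧ d ∣ t ∧ d ∣ u := by
  simp [Fin.forall_fin_succ, flagForm]
  tauto

theorem dvd_adjugate_flagForm_iff {R : Type*} [CommRing R] (d r s t u : R) :
    (∀ a b, d ∣ (flagForm r s t u).adjugate a b) ↔
      d ∣ r ^ 2 ∧ d ∣ r * s ∧ d ∣ r * t ∧ d ∣ s * u - t ^ 2 := by
  rw [adjugate_flagForm]
  simp [Fin.forall_fin_succ]
  tauto

/-- With `ρ`, `σ` the exponents of `r`, `s`, the determinant gives `2 * ρ + σ = 2 * i + j` and the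
minor `-r ^ 2` gives `i ≤ 2 * ρ`. Two solutions survive only for types `(2, 1)` and `(1, 2)`. The
wrong one would make `p` divide every entry in the first case, and `p ^ 2` divide every minor in the
second. -/
theorem HasType.flagForm_exponents {i j : ℕ} (hij : IsSpecialType i j) {r s t u : ℤ_[p]}
    (h : HasType i j (flagForm r s t u)) :
    ∃ (σ : ℕ) (ε η : ℤ_[p]ˣ), r = (p : ℤ_[p]) ^ cornerExp i j * ε ∧ s = (p : ℤ_[p]) ^ σ * η ∧
      2 * cornerExp i j + σ = 2 * i + j ∧ (r ∣ t ∨ s ∣ t) := by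
  obtain ⟨h1, h2, h3, δ, h4⟩ := h
  rw [dvd_flagForm_iff] at h1
  rw [dvd_adjugate_flagForm_iff] at h2 h3
  obtain ⟨h2a, h2b, h2c, h2d⟩ := h2
  rw [det_flagForm] at h4
  have hp : Prime (p : ℤ_[p]) := PadicInt.prime_p
  have hne : r ^ 2 * s ≠ 0 := by
    intro h0
    rw [h0, neg_zero] at h4
    exact mul_ne_zero (pow_ne_zero _ hp.ne_zero) δ.ne_zero h4.symm
  obtain ⟨ρ, ε, hr⟩ := padicInt_exists_eq_pow_mul_unit (x := r) (by rintro rfl; simp at hne)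
  obtain ⟨σ, η, hs⟩ := padicInt_exists_eq_pow_mul_unit (x := s) (by rintro rfl; simp at hne)
  have hsum : 2 * ρ + σ = 2 * i + j := by
    have e1 : r ^ 2 * s = (p : ℤ_[p]) ^ (2 * ρ + σ) * ((ε ^ 2 * η : ℤ_[p]ˣ) : ℤ_[p]) := by
      rw [hr, hs]; push_cast; ring
    have e2 : r ^ 2 * s = (p : ℤ_[p]) ^ (2 * i + j) * ((-δ : ℤ_[p]ˣ) : ℤ_[p]) := by
      push_cast; linear_combination -h4
    apply le_antisymm
    · rw [← padicInt_pow_dvd_pow_mul_unit (-δ), ← e2, e1]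
      exact dvd_mul_right _ _
    · rw [← padicInt_pow_dvd_pow_mul_unit (ε ^ 2 * η), ← e1, e2]
      exact dvd_mul_right _ _
  have hi : i ≤ 2 * ρ := by
    rw [← padicInt_pow_dvd_pow_mul_unit (ε ^ 2)]
    convert h2a using 1
    rw [hr]; push_cast; ring
  suffices ρ = cornerExp i j ∧ (r ∣ t ∨ s ∣ t) by
    obtain ⟨rfl, h⟩ := this
    exact ⟨σ, ε, η, hr, hs, hsum, h⟩
  have hrt : (p : ℤ_[p]) ^ ρ ∣ t → r ∣ t := fun h => by
    rwa [hr, Units.mul_right_dvd]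
  have hst : (p : ℤ_[p]) ^ σ ∣ t → s ∣ t := fun h => by
    rwa [hs, Units.mul_right_dvd]
  have hpr : ∀ k, (p : ℤ_[p]) ^ k ∣ r ↔ k ≤ ρ := fun k => by
    rw [hr, padicInt_pow_dvd_pow_mul_unit]
  have hps : ∀ k, (p : ℤ_[p]) ^ k ∣ s ↔ k ≤ σ := fun k => by
    rw [hs, padicInt_pow_dvd_pow_mul_unit]
  have hpt : 1 ≤ i → 1 ≤ σ → (p : ℤ_[p]) ∣ t := fun hi' hσ => by
    have e1 : (p : ℤ_[p]) ∣ s * u - t ^ 2 := (dvd_pow_self _ (by omega)).trans h2d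
    have e2 : (p : ℤ_[p]) ∣ s := by simpa using (hps 1).2 hσ
    exact hp.dvd_of_dvd_pow ((dvd_sub_right (e2.mul_right u)).1 e1)
  rcases hij.cases with ⟨rfl, rfl⟩ | ⟨rfl, rfl⟩ | ⟨rfl, rfl⟩ | ⟨rfl, rfl⟩ | ⟨rfl, rfl⟩ | ⟨rfl, rfl⟩
  · obtain rfl : ρ = 0 := by omega
    exact ⟨rfl, Or.inl (hrt (by simp))⟩
  · obtain rfl : ρ = 0 := by omega
    exact ⟨rfl, Or.inl (hrt (by simp))⟩
  · obtain rfl : ρ = 1 := by omega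
    obtain rfl : σ = 0 := by omega
    exact ⟨rfl, Or.inr (hst (by simp))⟩
  · obtain rfl : ρ = 1 := by omega
    obtain rfl : σ = 1 := by omega
    exact ⟨rfl, Or.inl (hrt (by simpa using hpt le_rfl le_rfl))⟩
  · obtain ⟨rfl, rfl⟩ | ⟨rfl, rfl⟩ : (ρ = 1 ∧ σ = 3) ∨ (ρ = 2 ∧ σ = 1) := by omega
    · exact ⟨rfl, Or.inl (hrt (by simpa using hpt (by omega) (by omega)))⟩
    · exfalso
      have ht := hpt (by omega) le_rfl
      have hsu : (p : ℤ_[p]) ^ 2 ∣ s * u := (dvd_sub_left (pow_dvd_pow_of_dvd ht 2)).1 h2d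
      have hu : (p : ℤ_[p]) ∣ u := by
        rw [hs, pow_one, pow_two, mul_assoc, mul_dvd_mul_iff_left hp.ne_zero,
          Units.dvd_mul_left] at hsu
        exact hsu
      exact h1 ⟨by simpa using (hpr 1).2 (by omega), by simpa using (hps 1).2 le_rfl, ht, hu⟩
  · obtain ⟨rfl, rfl⟩ | ⟨rfl, rfl⟩ : (ρ = 1 ∧ σ = 2) ∨ (ρ = 2 ∧ σ = 0) := by omega
    · exfalso
      have ht := hpt le_rfl (by omega)
      have hr1 : (p : ℤ_[p]) ∣ r := by simpa using (hpr 1).2 le_rfl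
      have hs2 : (p : ℤ_[p]) ^ 2 ∣ s := (hps 2).2 le_rfl
      exact h3 ⟨pow_dvd_pow_of_dvd hr1 2, hs2.mul_left _, by
        simpa [pow_two] using mul_dvd_mul hr1 ht,
        dvd_sub (hs2.mul_right _) (pow_dvd_pow_of_dvd ht 2)⟩
    · exact ⟨rfl, Or.inr (hst (by simp))⟩

theorem HasType.isRigid {i j : ℕ} (hij : IsSpecialType i j) {S : Matrix (Fin 3) (Fin 3) ℤ_[p]}
    (hS : HasType i j S) {r : ℤ_[p]} (hr : Associated ((p : ℤ_[p]) ^ cornerExp i j) r) :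
    IsRigid S r := by
  intro r' s' t' u' h
  obtain ⟨σ, ε, η, hr', -, -, ht⟩ := (hS.of_equivalent h).flagForm_exponents hij
  refine ⟨hr.symm.trans ⟨ε, hr'.symm⟩, ?_⟩
  rcases ht with ⟨a, ha⟩ | ⟨b, hb⟩
  · exact ⟨a, 0, by rw [ha]; ring⟩
  · exact ⟨0, b, by rw [hb]; ring⟩

/-- Here `s` is a unit and `r` is `p` up to a unit, while `p` divides the minor `s * u`. -/
theorem HasType.dvd_entry_of_right_eq_zero {r s u : ℤ_[p]}
    (h : HasType 1 0 (flagForm r s 0 u)) : r ∣ u := by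
  obtain ⟨σ, ε, η, hr, hs, hsum, -⟩ := h.flagForm_exponents (by simp [IsSpecialType])
  have hd := ((dvd_adjugate_flagForm_iff _ _ _ _ _).1 h.adjugate_dvd).2.2.2
  obtain rfl : σ = 0 := by simpa [cornerExp] using hsum
  rw [hr, Units.mul_right_dvd]
  rw [hs] at hd
  simpa [cornerExp] using hd

/-- When `p` divides both invariants, `u` has exactly one factor `p` fewer than `r`: one more factor
would contradict primitivity, or the exact power of `p` in the minors when `j = 2`. The last clause
makes the term `s * a ^ 2` disappear modulo `r` when two such forms are compared. -/
theorem HasType.exists_entry_eq {i j : ℕ} (hij : IsSpecialType i j) (hi : i ≠ 0) (hj : j ≠ 0)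
    {r s u : ℤ_[p]} (h : HasType i j (flagForm r s 0 u)) :
    ∃ (e : ℕ) (w : ℤ_[p]ˣ), e + 1 = cornerExp i j ∧ u = (p : ℤ_[p]) ^ e * w ∧
      ∀ a : ℤ_[p], (p : ℤ_[p]) ^ e ∣ s * a ^ 2 → r ∣ s * a ^ 2 := by
  obtain ⟨σ, ε, η, hr, hs, hsum, -⟩ := h.flagForm_exponents hij
  have h1 := h.entries
  have h2 := h.adjugate_dvd
  have h3 := h.adjugate_not_dvd
  rw [dvd_flagForm_iff] at h1
  rw [dvd_adjugate_flagForm_iff] at h2 h3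
  have hp : Prime (p : ℤ_[p]) := PadicInt.prime_p
  have hpr : ∀ k, (p : ℤ_[p]) ^ k ∣ r ↔ k ≤ cornerExp i j := fun k => by
    rw [hr, padicInt_pow_dvd_pow_mul_unit]
  have hps : ∀ k, (p : ℤ_[p]) ^ k ∣ s ↔ k ≤ σ := fun k => by
    rw [hs, padicInt_pow_dvd_pow_mul_unit]
  by_cases hj2 : j = 2
  · subst hj2
    obtain rfl : i = 1 := by obtain ⟨h1, h2, h3⟩ := hij; omega
    obtain rfl : σ = 0 := by simp [cornerExp] at hsum; omega
    have hsu : IsUnit s := ⟨η, by simp [hs]⟩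
    have hu : (p : ℤ_[p]) ∣ u := by
      have := h2.2.2.2
      rwa [zero_pow two_ne_zero, sub_zero, hsu.dvd_mul_left, pow_one] at this
    obtain ⟨w, rfl⟩ := hu
    have hw : IsUnit w := padicInt_isUnit_iff_not_dvd.2 fun ⟨d, hd⟩ => h3
      ⟨((hpr 2).2 le_rfl).trans (dvd_pow_self _ two_ne_zero), ((hpr 2).2 le_rfl).mul_right _,
        by simp, by subst hd; exact ⟨s * d, by ring⟩⟩
    obtain ⟨w, rfl⟩ := hw
    refine ⟨1, w, rfl, by simp, fun a ha => ?_⟩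
    rw [hsu.dvd_mul_left, pow_one] at ha
    rw [hr, Units.mul_right_dvd]
    exact (pow_dvd_pow_of_dvd (hp.dvd_of_dvd_pow ha) 2).mul_left _
  · have hc : cornerExp i j = 1 := by simp [cornerExp, hi, hj2]
    have hσ : 1 ≤ σ := by omega
    have hs1 : (p : ℤ_[p]) ∣ s := by simpa using (hps 1).2 hσ
    have hr1 : (p : ℤ_[p]) ∣ r := by simpa using (hpr 1).2 hc.ge
    have hu : IsUnit u := padicInt_isUnit_iff_not_dvd.2 fun hu => h1 ⟨hr1, hs1, by simp, hu⟩
    obtain ⟨w, rfl⟩ := hu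
    refine ⟨0, w, hc.symm, by simp, fun a _ => ?_⟩
    rw [hr, Units.mul_right_dvd, hc, pow_one]
    exact hs1.mul_right _

/-- Scaling the basis by `c⁻¹, 1, c` preserves `r` and `s` and multiplies `u` by `c ^ 2`. -/
theorem flagForm_equivalent_of_dvd {r s u u' : ℤ_[p]} (hodd : ∃ q, r * s = 2 * q + 1)
    (c : ℤ_[p]ˣ) (h : r ∣ u' - u * c ^ 2) :
    Equivalent (flagForm r s 0 u) (flagForm r s 0 u') := by
  have h1 := flagForm_scale r s 0 u ((c⁻¹ : ℤ_[p]ˣ) : ℤ_[p]) 1 (c : ℤ_[p]) (by simp)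
  have h2 := (flagForm_framedBy_of_dvd padicInt_two_dvd_sq_sub (u := (c : ℤ_[p]) ^ 2 * u)
    hodd (by rwa [mul_comm ((c : ℤ_[p]) ^ 2)])).equivalent
  simp only [Units.inv_mul, one_mul, one_pow, mul_zero] at h1
  exact h1.trans h2

/-- Converse of `flagForm_equivalent_of_dvd`. In the main case the last diagonal entry of `Aᵀ *
flagForm r s 0 u * A` reads `u' ≡ u * A 2 2 ^ 2 + s * A 1 2 ^ 2` modulo `r`. The second term
vanishes, and `A 2 2` is a unit since otherwise `u'` would be divisible by `p ^ (e + 1)`. -/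
theorem HasType.exists_unit_dvd {i j : ℕ} (hij : IsSpecialType i j) {r s u u' : ℤ_[p]}
    (h : HasType i j (flagForm r s 0 u))
    (he : Equivalent (flagForm r s 0 u) (flagForm r s 0 u')) :
    ∃ c : ℤ_[p]ˣ, r ∣ u' - u * c ^ 2 := by
  have h' := h.of_equivalent he
  by_cases hi : i = 0
  · subst hi
    obtain ⟨σ, ε, η, hr, -, -⟩ := h.flagForm_exponents hij
    refine ⟨1, IsUnit.dvd ⟨ε, by simp [hr, cornerExp]⟩⟩
  by_cases hj : j = 0
  · subst hj
    obtain rfl : i = 1 := by obtain ⟨h1, h2, h3⟩ := hij; omega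
    exact ⟨1, by simpa using dvd_sub h'.dvd_entry_of_right_eq_zero h.dvd_entry_of_right_eq_zero⟩
  obtain ⟨e, w, hec, hu, hsq⟩ := h.exists_entry_eq hij hi hj
  obtain ⟨e', w', hec', hu', -⟩ := h'.exists_entry_eq hij hi hj
  obtain rfl : e = e' := by omega
  obtain ⟨σ, ε, η, hr, -, -⟩ := h.flagForm_exponents hij
  obtain ⟨A, -, hA⟩ := equivalent_iff.1 he
  have e22 : (Aᵀ * flagForm r s 0 u * A) 2 2 = flagForm r s 0 u' 2 2 := by rw [hA]
  simp [flagForm, Matrix.mul_apply, Fin.sum_univ_three] at e22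
  have hpr : (p : ℤ_[p]) ^ (e + 1) ∣ r := by rw [hr, hec]; exact dvd_mul_right _ _
  have hsa : r ∣ s * A 1 2 ^ 2 := by
    apply hsq
    have : s * A 1 2 ^ 2 = u' - u * A 2 2 ^ 2 - r * (2 * A 0 2 * A 2 2) := by
      linear_combination e22
    rw [this, hu, hu']
    exact dvd_sub (dvd_sub (dvd_mul_right _ _) ((dvd_mul_right _ _).mul_right _))
      (((pow_dvd_pow _ (Nat.le_succ e)).trans hpr).mul_right _)
  obtain ⟨d, hd⟩ := hsa
  have hdvd : r ∣ u' - u * A 2 2 ^ 2 := ⟨d + 2 * A 0 2 * A 2 2, by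
    linear_combination -e22 + hd⟩
  have hunit : IsUnit (A 2 2) := padicInt_isUnit_iff_not_dvd.2 fun hA => by
    have h1 : (p : ℤ_[p]) ^ (e + 1) ∣ u' - u * A 2 2 ^ 2 := hpr.trans hdvd
    have h2 : (p : ℤ_[p]) ^ (e + 1) ∣ u * A 2 2 ^ 2 := by
      rw [hu, pow_succ]
      exact mul_dvd_mul (dvd_mul_right _ _) (hA.trans (dvd_pow_self _ two_ne_zero))
    have h3 := (dvd_sub_left h2).1 h1
    rw [hu', padicInt_pow_dvd_pow_mul_unit] at h3
    omega
  obtain ⟨c, hc⟩ := hunit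
  exact ⟨c, by rwa [hc]⟩

end Local

theorem card_range_eq_of_iff {ι α β : Type*} {f : ι → α} {g : ι → β}
    (h : ∀ a b, f a = f b ↔ g a = g b) : Nat.card (Set.range f) = Nat.card (Set.range g) :=
  Nat.card_congr <| (Setoid.quotientKerEquivRange f).symm.trans <|
    (Quotient.congrRight fun a b => h a b).trans (Setoid.quotientKerEquivRange g)

/-! ### Counting local residues -/

section LocalCount

variable {p : ℕ} [Fact p.Prime]

theorem toZModPow_eq_iff (n : ℕ) (u u' : ℤ_[p]) :
    PadicInt.toZModPow n u = PadicInt.toZModPow n u' ↔ (p : ℤ_[p]) ^ n ∣ u' - u := by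
  rw [← Ideal.mem_span_singleton, ← PadicInt.ker_toZModPow, RingHom.mem_ker, map_sub, sub_eq_zero,
    eq_comm]

/-- After cancelling `p ^ n * w`, only `c ^ 2` modulo `p` matters, and half of the cyclic group
`(ZMod p)ˣ` consists of squares. -/
theorem card_range_sq_mod (hp : p ≠ 2) (n : ℕ) (w : ℤ_[p]ˣ) :
    Nat.card (Set.range fun c : ℤ_[p]ˣ =>
      PadicInt.toZModPow (n + 1) ((p : ℤ_[p]) ^ n * (w : ℤ_[p]) * (c : ℤ_[p]) ^ 2)) = (p - 1) / 2 := by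
  let φ : ℤ_[p]ˣ →* (ZMod p)ˣ := Units.map (PadicInt.toZMod (p := p) : ℤ_[p] →* ZMod p)
  have hφ : Function.Surjective φ := by
    have hs : Function.Surjective (PadicInt.toZMod (p := p)) := ZMod.ringHom_surjective _
    exact IsLocalRing.surjective_units_map_of_local_ringHom _ hs hs.isLocalHom
  rw [card_range_eq_of_iff (g := fun c => φ c ^ 2)]
  · have : (Set.range fun c => φ c ^ 2) = ((powMonoidHom 2 : (ZMod p)ˣ →* (ZMod p)ˣ).range : Set _) := by
      ext v
      constructor
      · rintro ⟨c, rfl⟩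
        exact ⟨φ c, rfl⟩
      · rintro ⟨d, rfl⟩
        obtain ⟨c, rfl⟩ := hφ d
        exact ⟨c, rfl⟩
    rw [this]
    have hc := IsCyclic.card_powMonoidHom_range (G := (ZMod p)ˣ) 2
    have hp2 : 2 ∣ p - 1 := ((Fact.out : p.Prime).even_sub_one hp).two_dvd
    rw [Nat.card_eq_fintype_card (α := (ZMod p)ˣ), ZMod.card_units p, Nat.gcd_eq_right hp2] at hc
    exact hc
  · intro a b
    rw [toZModPow_eq_iff, ← mul_sub, mul_assoc, pow_succ,
      mul_dvd_mul_iff_left (pow_ne_zero _ PadicInt.prime_p.ne_zero), Units.dvd_mul_left,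
      Units.ext_iff]
    change _ ↔ PadicInt.toZMod (a : ℤ_[p]) ^ 2 = PadicInt.toZMod (b : ℤ_[p]) ^ 2
    rw [← map_pow, ← map_pow, ← Ideal.mem_span_singleton, ← PadicInt.maximalIdeal_eq_span_p,
      ← PadicInt.ker_toZMod, RingHom.mem_ker, map_sub, sub_eq_zero, eq_comm]

/-- If `i` and `j` are nonzero, the residues are those of `u * c ^ 2` for units `c`. If `i = 0` the
modulus is 1, and for type `(1, 0)` every admissible `v` is divisible by `r`. -/
theorem HasType.card_corner_residues {i j : ℕ} (hij : IsSpecialType i j)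
    {S : Matrix (Fin 3) (Fin 3) ℤ_[p]} (hS : HasType i j S) {r s u : ℤ_[p]}
    (hodd : ∃ q, r * s = 2 * q + 1) (h : Equivalent S (flagForm r s 0 u))
    (hp : i ≠ 0 → p ≠ 2) :
    Nat.card {q : ZMod (p ^ cornerExp i j) // ∃ v, PadicInt.toZModPow (cornerExp i j) v = q ∧
      Equivalent S (flagForm r s 0 v)} = if i ≠ 0 ∧ j ≠ 0 then (p - 1) / 2 else 1 := by
  have hF := hS.of_equivalent h
  obtain ⟨σ, ε, η, hr, -, -⟩ := hF.flagForm_exponents hij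
  have hdvd : ∀ x, r ∣ x ↔ (p : ℤ_[p]) ^ cornerExp i j ∣ x := fun x => by
    rw [hr, Units.mul_right_dvd]
  split_ifs with hc
  · obtain ⟨e, w, hec, rfl, -⟩ := hF.exists_entry_eq hij hc.1 hc.2
    rw [← card_range_sq_mod (hp hc.1) e w]
    rw [← hec]
    rw [← hec] at hdvd
    congr! 2
    ext q
    constructor
    · rintro ⟨v, rfl, hv⟩
      obtain ⟨c, hcv⟩ := hF.exists_unit_dvd hij (h.symm.trans hv)
      exact ⟨c, (toZModPow_eq_iff _ _ _).2 ((hdvd _).1 hcv)⟩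
    · rintro ⟨c, rfl⟩
      exact ⟨_, rfl, h.trans (flagForm_equivalent_of_dvd hodd c (by simp))⟩
  · rw [Nat.card_eq_one_iff_unique]
    refine ⟨⟨?_⟩, ⟨⟨_, u, rfl, h⟩⟩⟩
    have key : ∀ v, Equivalent S (flagForm r s 0 v) → r ∣ v - u := by
      intro v hv
      have hv' := hS.of_equivalent hv
      by_cases hi : i = 0
      · subst hi
        exact (hdvd _).2 (by simp [cornerExp])
      · obtain rfl : j = 0 := by tauto
        obtain rfl : i = 1 := by obtain ⟨h1, h2, h3⟩ := hij; omega
        exact dvd_sub hv'.dvd_entry_of_right_eq_zero hF.dvd_entry_of_right_eq_zero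
    rintro ⟨_, v, rfl, hv⟩ ⟨_, v', rfl, hv'⟩
    apply Subtype.ext
    change PadicInt.toZModPow _ v = PadicInt.toZModPow _ v'
    rw [toZModPow_eq_iff, ← hdvd]
    simpa using dvd_sub (key v' hv') (key v hv)

end LocalCount

/-! ### Minkowski's theorem and a convex cylinder -/

section Minkowski

open MeasureTheory

/-- Minkowski's theorem for a subgroup of finite index in `ℤ³`. -/
theorem exists_ne_zero_mem_of_index_lt (H : AddSubgroup (Fin 3 → ℤ)) (hH : H.index ≠ 0)
    {s : Set (Fin 3 → ℝ)} (hsymm : ∀ x ∈ s, -x ∈ s) (hconv : Convex ℝ s)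
    (hvol : (H.index : ENNReal) * 8 < volume s) :
    ∃ v ∈ H, v ≠ 0 ∧ (fun i => (v i : ℝ)) ∈ s := by
  let ι : (Fin 3 → ℤ) →+ (Fin 3 → ℝ) := (Int.castAddHom ℝ).compLeft (Fin 3)
  have hι : Function.Injective ι := fun v w h => funext fun i => by
    have := congrFun h i
    simpa [ι] using this
  let b := Pi.basisFun ℝ (Fin 3)
  let L₂ : Submodule ℤ (Fin 3 → ℝ) := Submodule.span ℤ (Set.range b)
  let L₁ : Submodule ℤ (Fin 3 → ℝ) := AddSubgroup.toIntSubmodule (H.map ι)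
  have hL₂ : L₂.toAddSubgroup = (⊤ : AddSubgroup (Fin 3 → ℤ)).map ι := by
    ext x
    simp only [Submodule.mem_toAddSubgroup, L₂, b.mem_span_iff_repr_mem ℤ]
    constructor
    · intro h
      choose v hv using h
      exact ⟨v, trivial, funext fun i => by simpa [ι, b] using hv i⟩
    · rintro ⟨v, -, rfl⟩ i
      exact ⟨v i, by simp [ι, b]⟩
  have hle : L₁ ≤ L₂ := by
    intro x hx
    have : x ∈ L₂.toAddSubgroup := by
      rw [hL₂]
      exact AddSubgroup.map_mono le_top hx
    exact this
  have : DiscreteTopology L₂ := inferInstance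
  have : DiscreteTopology L₁ := DiscreteTopology.of_subset this hle
  have : IsZLattice ℝ L₁ := by
    constructor
    rw [eq_top_iff, ← b.span_eq, Submodule.span_le]
    rintro _ ⟨i, rfl⟩
    have h1 : H.index • (Pi.single i 1 : Fin 3 → ℤ) ∈ H := AddSubgroup.nsmul_index_mem _ _
    have h2 : ι (H.index • (Pi.single i 1 : Fin 3 → ℤ)) ∈
        Submodule.span ℝ (L₁ : Set (Fin 3 → ℝ)) :=
      Submodule.subset_span (AddSubgroup.mem_map_of_mem ι h1)
    have h3 : ι (H.index • (Pi.single i 1 : Fin 3 → ℤ)) = (H.index : ℝ) • b i := by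
      ext j
      rw [map_nsmul]
      by_cases hij : j = i <;> simp [ι, b, hij]
    rw [h3] at h2
    exact (Submodule.smul_mem_iff _ (by exact_mod_cast hH)).1 h2
  -- As `ℤ³` has covolume 1, the covolume of the sublattice is its index.
  have hcov2 : ZLattice.covolume L₂ = 1 := by
    rw [ZLattice.covolume_eq_measure_fundamentalDomain L₂ volume (ZSpan.isAddFundamentalDomain b _),
      ZSpan.volume_real_fundamentalDomain]
    have : Matrix.of (⇑b) = 1 := by
      ext i j
      simp [b, Pi.single_apply, Matrix.one_apply, eq_comm]
    simp [this]
  have hcov1 : ZLattice.covolume L₁ = H.index := by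
    have h := ZLattice.covolume_div_covolume_eq_relIndex L₁ L₂ hle
    rw [hcov2, div_one, hL₂] at h
    rw [h]
    have : L₁.toAddSubgroup = H.map ι := rfl
    rw [this, AddSubgroup.relIndex_map_map_of_injective _ _ hι, AddSubgroup.relIndex_top_right]
  let b₁ := IsZLattice.basis L₁
  have hfund := ZLattice.isAddFundamentalDomain b₁ volume
  have hvolF : volume (ZSpan.fundamentalDomain (b₁.ofZLatticeBasis ℝ)) = H.index := by
    rw [ZLattice.covolume_eq_measure_fundamentalDomain L₁ volume hfund] at hcov1
    rw [← ENNReal.ofReal_toReal (a := volume (ZSpan.fundamentalDomain _)), ← measureReal_def, hcov1]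
    · simp
    · exact (ZSpan.fundamentalDomain_isBounded _).measure_lt_top.ne
  have : Countable L₁.toAddSubgroup := by
    change Countable L₁
    infer_instance
  obtain ⟨⟨x, hx⟩, hx0, hxs⟩ := exists_ne_zero_mem_lattice_of_measure_mul_two_pow_lt_measure
    (L := L₁.toAddSubgroup) hfund hsymm hconv (by
      rw [hvolF]
      norm_num
      exact hvol)
  obtain ⟨v, hv, rfl⟩ := hx
  refine ⟨v, hv, ?_, hxs⟩
  rintro rfl
  exact hx0 (Subtype.ext (map_zero ι))

/-- On this convex body `|w 0 ^ 2 - w 1 ^ 2 - w 2 ^ 2| < a ^ 2`, which is how it replaces the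
nonconvex region of small values of an indefinite form. -/
theorem volume_cylinder {a : ℝ} (ha : 0 ≤ a) :
    volume {w : Fin 3 → ℝ | |w 0| < a ∧ w 1 ^ 2 + w 2 ^ 2 < a ^ 2} =
      ENNReal.ofReal (2 * Real.pi * a ^ 3) := by
  let D : Set (Fin 2 → ℝ) := {w | w 0 ^ 2 + w 1 ^ 2 < a ^ 2}
  have hD : volume D = ENNReal.ofReal (Real.pi * a ^ 2) := by
    have h1 := Complex.volume_preserving_equiv_pi.measure_preimage_equiv D
    have h2 : Complex.measurableEquivPi ⁻¹' D = Metric.ball (0 : ℂ) a := by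
      ext z
      simp only [D, Set.mem_preimage, Set.mem_ofPred_eq, Complex.measurableEquivPi_apply,
        mem_ball_zero_iff, Matrix.cons_val_zero, Matrix.cons_val_one]
      rw [← abs_of_nonneg (norm_nonneg z), ← abs_of_nonneg ha, ← sq_lt_sq, abs_of_nonneg ha,
        Complex.sq_norm, Complex.normSq_apply, pow_two, pow_two]
    rw [← h1, h2, Complex.volume_ball, ENNReal.ofReal_mul Real.pi_pos.le, mul_comm,
      ENNReal.ofReal_pow ha]
    congr 1
    rw [← NNReal.coe_real_pi, ENNReal.ofReal_coe_nnreal]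
  have h := (volume_preserving_piFinSuccAbove (fun _ : Fin 3 => ℝ) 0).measure_preimage_equiv
    (Set.Ioo (-a) a ×ˢ D)
  have hset : {w : Fin 3 → ℝ | |w 0| < a ∧ w 1 ^ 2 + w 2 ^ 2 < a ^ 2} =
      (MeasurableEquiv.piFinSuccAbove (fun _ : Fin 3 => ℝ) 0) ⁻¹' (Set.Ioo (-a) a ×ˢ D) := by
    ext w
    simp only [D, Set.mem_ofPred_eq, Set.mem_preimage, Set.mem_prod, abs_lt]
    rfl
  rw [hset, h, Measure.volume_eq_prod, Measure.prod_prod, hD, Real.volume_Ioo,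
    ← ENNReal.ofReal_mul (by linarith)]
  congr 1
  ring

theorem convex_cylinder (a : ℝ) :
    Convex ℝ {w : Fin 3 → ℝ | |w 0| < a ∧ w 1 ^ 2 + w 2 ^ 2 < a ^ 2} := by
  intro x hx y hy p q hp hq hpq
  simp only [Set.mem_ofPred_eq, Pi.add_apply, Pi.smul_apply, smul_eq_mul] at *
  obtain rfl : q = 1 - p := by linarith
  constructor
  · have h1 := hx.1
    have h2 := hy.1
    rw [abs_lt] at *
    constructor
    · rcases hp.eq_or_lt with rfl | hp
      · linarith
      · nlinarith
    · rcases hp.eq_or_lt with rfl | hp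
      · linarith
      · nlinarith
  · have h1 : p * (1 - p) * ((x 1 - y 1) ^ 2 + (x 2 - y 2) ^ 2) ≥ 0 := by positivity
    rcases hp.eq_or_lt with rfl | hp
    · simpa using hy.2
    · nlinarith [mul_lt_mul_of_pos_left hx.2 hp, mul_le_mul_of_nonneg_left hy.2.le hq]

end Minkowski

/-! ### Isotropy of every form in the genus -/

section Isotropy

theorem value_flagForm {R : Type*} [CommRing R] (r s t u : R) (x : Fin 3 → R) :
    value (flagForm r s t u) x =
      2 * r * x 0 * x 2 + s * x 1 ^ 2 + 2 * t * x 1 * x 2 + u * x 2 ^ 2 := by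
  simp [value, flagForm, Matrix.mulVec, dotProduct, Fin.sum_univ_three]
  ring

theorem value_conj {R : Type*} [CommRing R] (S A : Matrix (Fin 3) (Fin 3) R) (x : Fin 3 → R) :
    value (Aᵀ * S * A) x = value S (A *ᵥ x) := by
  unfold value
  rw [← Matrix.mulVec_mulVec, ← Matrix.mulVec_mulVec, Matrix.dotProduct_mulVec x,
    Matrix.vecMul_transpose]

theorem value_baseChange {R : Type*} [CommRing R] (S : Matrix (Fin 3) (Fin 3) ℤ)
    (v : Fin 3 → ℤ) : value (baseChange R S) (fun i => (v i : R)) = ((value S v : ℤ) : R) := by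
  simp [value, baseChange, Matrix.mulVec, dotProduct, Fin.sum_univ_three]

/-- The vectors of `ℤ³` lying in the sublattice spanned `p`-adically by `x`, `p ^ a y` and
`p ^ (a + b) z`, where `x, y, z` is a basis with Gram matrix `flagForm r s 0 u`. -/
theorem exists_local_sublattice (p : ℕ) [Fact p.Prime] {S : Matrix (Fin 3) (Fin 3) ℤ}
    {r s u : ℤ} {a b : ℕ} (hr : (p ^ a : ℤ) ∣ r) (hs : (p ^ b : ℤ) ∣ s)
    (h : Equivalent (baseChange ℤ_[p] (flagForm r s 0 u)) (baseChange ℤ_[p] S)) :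
    ∃ H : AddSubgroup (Fin 3 → ℤ), H.index ≠ 0 ∧ H.index ≤ p ^ (2 * a + b) ∧
      ∀ v ∈ H, (p ^ (2 * a + b) : ℤ) ∣ value S v := by
  obtain ⟨A, -, hA⟩ := equivalent_iff.1 h
  let ι : (Fin 3 → ℤ) →+ (Fin 3 → ℤ_[p]) := (Int.castAddHom ℤ_[p]).compLeft (Fin 3)
  let ev (i : Fin 3) : (Fin 3 → ℤ) →+ ℤ_[p] :=
    (Pi.evalAddMonoidHom (fun _ : Fin 3 => ℤ_[p]) i).comp ((Matrix.mulVecLin A).toAddMonoidHom.comp ι)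
  -- `A` passes to the coordinates `X, Y, Z` of `flagForm`. If `p ^ a ∣ Y` and `p ^ (a + b) ∣ Z`,
  -- each of `2 * r * X * Z`, `s * Y ^ 2`, `u * Z ^ 2` is divisible by `p ^ (2 * a + b)`, which is
  -- also the order of the target of `φ`.
  let φ : (Fin 3 → ℤ) →+ ZMod (p ^ a) × ZMod (p ^ (a + b)) :=
    ((PadicInt.toZModPow a).toAddMonoidHom.comp (ev 1)).prod
      ((PadicInt.toZModPow (a + b)).toAddMonoidHom.comp (ev 2))
  have hp0 : p ≠ 0 := (Fact.out : p.Prime).ne_zero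
  have : NeZero (p ^ a) := ⟨pow_ne_zero _ hp0⟩
  have : NeZero (p ^ (a + b)) := ⟨pow_ne_zero _ hp0⟩
  refine ⟨φ.ker, ?_, ?_, fun v hv => ?_⟩
  · rw [AddSubgroup.index_ker]
    exact Nat.card_pos.ne'
  · rw [AddSubgroup.index_ker]
    refine (Nat.card_le_card_of_injective _ Subtype.val_injective).trans ?_
    rw [Nat.card_prod, Nat.card_zmod, Nat.card_zmod, ← pow_add]
    exact (congrArg (p ^ ·) (by ring)).le
  · have hv' : φ v = 0 := hv
    have h1 : PadicInt.toZModPow a ((A *ᵥ fun i => (v i : ℤ_[p])) 1) = 0 := congrArg Prod.fst hv'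
    have h2 : PadicInt.toZModPow (a + b) ((A *ᵥ fun i => (v i : ℤ_[p])) 2) = 0 :=
      congrArg Prod.snd hv'
    rw [← RingHom.mem_ker, PadicInt.ker_toZModPow, Ideal.mem_span_singleton] at h1 h2
    have h3 : ((p : ℤ_[p]) ^ (2 * a + b)) ∣ ((value S v : ℤ) : ℤ_[p]) := by
      rw [← value_baseChange, ← hA, value_conj, baseChange_flagForm, value_flagForm]
      obtain ⟨y, hy⟩ := h1
      obtain ⟨z, hz⟩ := h2
      obtain ⟨r', rfl⟩ := hr
      obtain ⟨s', rfl⟩ := hs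
      rw [hy, hz]
      push_cast
      refine ⟨2 * r' * (A *ᵥ fun i => (v i : ℤ_[p])) 0 * z + s' * y ^ 2 +
        u * p ^ b * z ^ 2, ?_⟩
      ring
    exact (PadicInt.pow_p_dvd_int_iff _ _).1 h3

/-- Modulo 2 the cross terms vanish and `n ^ 2 ≡ n`, so the form is the linear form of its diagonal.
-/
theorem exists_even_sublattice {S : Matrix (Fin 3) (Fin 3) ℤ} (hS : S.IsSymm) :
    ∃ H : AddSubgroup (Fin 3 → ℤ), H.index ≠ 0 ∧ H.index ≤ 2 ∧ ∀ v ∈ H, 2 ∣ value S v := by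
  let φ : (Fin 3 → ℤ) →+ ZMod 2 :=
    { toFun := fun v => (∑ i, S i i * v i : ℤ)
      map_zero' := by simp
      map_add' := fun v w => by simp [mul_add, Finset.sum_add_distrib] }
  refine ⟨φ.ker, ?_, ?_, fun v hv => ?_⟩
  · rw [AddSubgroup.index_ker]
    exact Nat.card_pos.ne'
  · rw [AddSubgroup.index_ker]
    refine (Nat.card_le_card_of_injective _ Subtype.val_injective).trans ?_
    simp
  · have h1 : ((∑ i, S i i * v i : ℤ) : ZMod 2) = 0 := hv
    rw [ZMod.intCast_zmod_eq_zero_iff_dvd] at h1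
    have e10 := hS.apply 0 1
    have e20 := hS.apply 0 2
    have e21 := hS.apply 1 2
    have hsq : ∀ n : ℤ, (2 : ℤ) ∣ n * (n - 1) := fun n => (Int.even_mul_pred_self n).two_dvd
    have h2 : value S v = ∑ i, S i i * v i + (S 0 0 * (v 0 * (v 0 - 1)) +
        S 1 1 * (v 1 * (v 1 - 1)) + S 2 2 * (v 2 * (v 2 - 1))) +
        2 * (S 0 1 * v 0 * v 1 + S 0 2 * v 0 * v 2 + S 1 2 * v 1 * v 2) := by
      simp [value, Matrix.mulVec, dotProduct, Fin.sum_univ_three, e10, e20, e21]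
      ring
    rw [h2]
    exact dvd_add (dvd_add h1 (dvd_add (dvd_add ((hsq _).mul_left _) ((hsq _).mul_left _))
      ((hsq _).mul_left _))) (dvd_mul_right _ _)

theorem primitiveZeros_nonempty_of_value_eq_zero {S : Matrix (Fin 3) (Fin 3) ℤ} {v : Fin 3 → ℤ}
    (hv : v ≠ 0) (h : value S v = 0) : (primitiveZeros S).Nonempty := by
  obtain ⟨w, hw, hw1⟩ := Finset.extract_gcd v (Finset.univ_nonempty (α := Fin 3))
  set g := Finset.univ.gcd v with hg
  have hg0 : g ≠ 0 := fun h0 => hv (funext fun i => by simp [hw i, h0])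
  refine ⟨w, fun d hd => isUnit_of_dvd_one (hw1 ▸ Finset.dvd_gcd fun i _ => hd i), ?_⟩
  have h1 : value S v = g ^ 2 * value S w := by
    simp [value, Matrix.mulVec, dotProduct, Fin.sum_univ_three, hw]
    ring
  rw [h1] at h
  exact (mul_eq_zero.1 h).resolve_left (pow_ne_zero 2 hg0)

theorem real_two_dvd (c : ℝ) : 2 ∣ c ^ 2 - c := (isUnit_iff_ne_zero.2 two_ne_zero).dvd

/-- Over a field the corner can be scaled to 1, after which `t` and `u` can be cleared. One normal
form for all zeros yields both the single real orbit and `real_equivalent_of_det_eq`. -/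
theorem real_exists_framedBy {S : Matrix (Fin 3) (Fin 3) ℝ} (hS : S.IsSymm) (hdet : S.det ≠ 0)
    {x : Fin 3 → ℝ} (hx : x ∈ primitiveZeros S) :
    FramedBy S x (flagForm 1 (-S.det) 0 0) := by
  have hrig : IsRigid S 1 := by
    intro r' s' t' u' h
    obtain ⟨ε, hε⟩ := h.exists_det_eq
    have hr' : r' ≠ 0 := by
      rintro rfl
      rw [det_flagForm] at hε
      have : (ε : ℝ) ^ 2 * S.det ≠ 0 := mul_ne_zero (pow_ne_zero _ ε.ne_zero) hdet
      exact this (by rw [← hε]; ring)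
    exact ⟨associated_of_dvd_dvd (one_dvd _) (isUnit_iff_ne_zero.2 hr').dvd,
      t' / r', 0, by field_simp; ring⟩
  obtain ⟨u, hu⟩ := hrig.exists_framedBy hS one_ne_zero (s := -S.det) (by ring) hx
  exact hu.trans (flagForm_framedBy_of_dvd real_two_dvd
    ⟨(1 * -S.det - 1) / 2, by ring⟩ (one_dvd _))

theorem real_equivalent_of_det_eq {S S' : Matrix (Fin 3) (Fin 3) ℝ} (hS : S.IsSymm)
    (hS' : S'.IsSymm) (hdet : S.det ≠ 0) (h : S.det = S'.det) (hx : (primitiveZeros S).Nonempty)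
    (hx' : (primitiveZeros S').Nonempty) : Equivalent S S' := by
  obtain ⟨x, hx⟩ := hx
  obtain ⟨x', hx'⟩ := hx'
  have h1 := (real_exists_framedBy hS hdet hx).equivalent
  have h2 := (real_exists_framedBy hS' (h ▸ hdet) hx').equivalent
  rw [← h] at h2
  exact h1.trans h2.symm

/-- An indefinite ternary form over `ℤ` that is everywhere locally equivalent to an isotropic form
`flagForm r s 0 u` of odd determinant is isotropic. -/
theorem isIsotropic_of_locally_equivalent {S : Matrix (Fin 3) (Fin 3) ℤ} (hS : S.IsSymm)
    {r s u : ℤ} (hpos : 0 < -(r ^ 2 * s)) (hodd : Odd (r ^ 2 * s)) (hdet : S.det = -(r ^ 2 * s))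
    (hp : ∀ p : Nat.Primes, Equivalent (baseChange ℤ_[(p : ℕ)] (flagForm r s 0 u))
      (baseChange ℤ_[(p : ℕ)] S))
    (hreal : Equivalent (baseChange ℝ S) (baseChange ℝ (flagForm r s 0 u))) :
    IsIsotropic S := by
  obtain ⟨D, hD⟩ : ∃ D : ℕ, (D : ℤ) = -(r ^ 2 * s) := ⟨_, Int.toNat_of_nonneg hpos.le⟩
  have hDpos : 0 < D := by omega
  have hr0 : r ≠ 0 := by rintro rfl; simp at hpos
  have hs0 : s ≠ 0 := by rintro rfl; simp at hpos
  have hDabs : D = r.natAbs ^ 2 * s.natAbs := by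
    have := congrArg Int.natAbs hD
    simpa [Int.natAbs_mul, Int.natAbs_pow] using this
  have hfac : ∀ q, 2 * r.natAbs.factorization q + s.natAbs.factorization q = D.factorization q := by
    intro q
    rw [hDabs, Nat.factorization_mul (by positivity) (by positivity), Nat.factorization_pow]
    simp
  have hloc : ∀ q : D.primeFactors, ∃ H : AddSubgroup (Fin 3 → ℤ), H.index ≠ 0 ∧
      H.index ≤ (q : ℕ) ^ D.factorization q ∧
      ∀ v ∈ H, ((q : ℕ) ^ D.factorization q : ℤ) ∣ value S v := by
    intro q
    have hq : (q : ℕ).Prime := Nat.prime_of_mem_primeFactors q.2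
    have : Fact (q : ℕ).Prime := ⟨hq⟩
    rw [← hfac]
    refine exists_local_sublattice q ?_ ?_ (hp ⟨q, hq⟩)
    · exact Int.natCast_dvd.2 (by simpa using Nat.ordProj_dvd r.natAbs q) |>.trans (by simp)
    · exact Int.natCast_dvd.2 (by simpa using Nat.ordProj_dvd s.natAbs q) |>.trans (by simp)
  choose H hH0 hHle hHdvd using hloc
  obtain ⟨E, hE0, hEle, hEdvd⟩ := exists_even_sublattice hS
  have hinf0 : (⨅ q, H q).index ≠ 0 := AddSubgroup.index_iInf_ne_zero hH0
  have hinfle : (⨅ q, H q).index ≤ D := by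
    refine (AddSubgroup.index_iInf_le H).trans ((Finset.prod_le_prod' fun q _ => hHle q).trans ?_)
    exact (Nat.prod_primeFactors_coe_pow_factorization hDpos.ne').symm.le
  -- The form takes values divisible by `2 * D` on `L`, whose index is at most `2 * D`; a nonzero
  -- vector of `L` with value below `2 * D` in absolute value is therefore a zero.
  let L := (⨅ q, H q) ⊓ E
  have hL0 : L.index ≠ 0 := AddSubgroup.index_inf_ne_zero hinf0 hE0
  have hLle : L.index ≤ D * 2 :=
    AddSubgroup.index_inf_le.trans (Nat.mul_le_mul hinfle hEle)
  have hLdvd : ∀ v ∈ L, ((2 * D : ℕ) : ℤ) ∣ value S v := by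
    rintro v ⟨hv1, hv2⟩
    have h2 : (2 : ℤ) ∣ value S v := hEdvd v hv2
    have hD' : (D : ℤ) ∣ value S v := by
      rw [Int.natCast_dvd, Nat.dvd_iff_prime_pow_dvd_dvd]
      intro q k hq hqk
      by_cases hqD : q ∈ D.primeFactors
      · have h3 := hHdvd ⟨q, hqD⟩ v ((AddSubgroup.mem_iInf.1 hv1) _)
        have h4 : q ^ D.factorization q ∣ (value S v).natAbs := by
          rw [← Int.natCast_dvd]
          exact_mod_cast h3
        exact (pow_dvd_pow _ ((hq.pow_dvd_iff_le_factorization hDpos.ne').1 hqk)).trans h4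
      · have : k = 0 := by
          by_contra hk
          exact hqD (Nat.mem_primeFactors.2 ⟨hq, (dvd_pow_self _ hk).trans hqk, hDpos.ne'⟩)
        simp [this]
    push_cast
    refine IsCoprime.mul_dvd ?_ h2 hD'
    have hDodd : Odd D := by
      rw [← Int.odd_coe_nat, hD]
      exact hodd.neg
    exact Nat.isCoprime_iff_coprime.2 (Nat.coprime_two_left.2 hDodd)
  have hDR : (0 : ℝ) < D := by exact_mod_cast hDpos
  have hdiag : Equivalent (!![1, 0, 0; 0, -1, 0; 0, 0, -1] : Matrix (Fin 3) (Fin 3) ℝ)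
      (baseChange ℝ S) := by
    have hdetR : (baseChange ℝ S).det = (D : ℝ) := by
      rw [det_baseChange, hdet, ← hD]
      simp
    obtain ⟨A, hA⟩ := hreal
    have hx := mem_zeros hA (by rw [baseChange_flagForm]; exact flagForm_zero_mem _ _ _ _)
    have h1 := (real_exists_framedBy (IsSymm.baseChange hS) (by rw [hdetR]; exact hDR.ne')
      hx).equivalent
    -- In `2 * x * z - D * y ^ 2` put `x = (w₀ + w₂) / 2`, `y = w₁ / √D`, `z = w₀ - w₂`.
    refine (h1.trans (equivalent_iff.2
      ⟨!![1 / 2, 0, 1 / 2; 0, 1 / Real.sqrt D, 0; 1, 0, -1], ?_, ?_⟩)).symm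
    · have : Real.sqrt D ≠ 0 := (Real.sqrt_pos.2 hDR).ne'
      simp [Matrix.det_fin_three]
      field_simp
      norm_num
    · have : Real.sqrt D ≠ 0 := (Real.sqrt_pos.2 hDR).ne'
      rw [hdetR]
      ext i j
      fin_cases i <;> fin_cases j <;>
        simp [flagForm, Matrix.mul_apply, Fin.sum_univ_three]
      · norm_num
      · rw [inv_mul_eq_div, div_mul_eq_mul_div, div_eq_one_iff_eq this, ← div_eq_mul_inv,
          Real.div_sqrt]
      · norm_num
  obtain ⟨B, -, hB⟩ := equivalent_iff.1 hdiag
  have hBdet : B.det ^ 2 = D := by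
    have h1 : (baseChange ℝ S).det = (D : ℝ) := by
      rw [det_baseChange, hdet, ← hD]
      simp
    rw [← h1, ← hB]
    simp [Matrix.det_mul, Matrix.det_fin_three]
    ring
  have hBval : ∀ v : Fin 3 → ℤ, ((value S v : ℤ) : ℝ) = (B *ᵥ fun i => (v i : ℝ)) 0 ^ 2 -
      (B *ᵥ fun i => (v i : ℝ)) 1 ^ 2 - (B *ᵥ fun i => (v i : ℝ)) 2 ^ 2 := by
    intro v
    rw [← value_baseChange, ← hB, value_conj]
    generalize B *ᵥ (fun i => (v i : ℝ)) = w
    simp [value, Matrix.mulVec, dotProduct, Fin.sum_univ_three]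
    ring
  -- With `a ^ 2 = 2 * D` the body has volume `2 * π * a ^ 3 / √D = 4 * √2 * π * D`. This exceeds
  -- `16 * D`, hence `8` times the index, because `π ^ 2 > 8`.
  set a := Real.sqrt (2 * D) with ha
  have ha2 : a ^ 2 = 2 * D := Real.sq_sqrt (by positivity)
  have ha0 : 0 < a := Real.sqrt_pos.2 (by positivity)
  let K := {w : Fin 3 → ℝ | |w 0| < a ∧ w 1 ^ 2 + w 2 ^ 2 < a ^ 2}
  have hBdet0 : B.det ≠ 0 := fun h0 => by
    rw [h0, zero_pow two_ne_zero] at hBdet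
    exact hDR.ne hBdet
  have hvol : (L.index : ENNReal) * 8 < MeasureTheory.volume (B.mulVecLin ⁻¹' K) := by
    rw [MeasureTheory.Measure.addHaar_preimage_linearMap _
      (by rwa [← Matrix.toLin'_apply', LinearMap.det_toLin']), volume_cylinder ha0.le,
      ← ENNReal.ofReal_mul (abs_nonneg _), ← Matrix.toLin'_apply', LinearMap.det_toLin']
    refine lt_of_le_of_lt (b := ENNReal.ofReal (16 * D)) ?_ ?_
    · rw [← ENNReal.ofReal_natCast, show (8 : ENNReal) = ENNReal.ofReal 8 by simp,
        ← ENNReal.ofReal_mul (by positivity)]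
      apply ENNReal.ofReal_le_ofReal
      have : (L.index : ℝ) ≤ D * 2 := by exact_mod_cast hLle
      linarith
    · rw [ENNReal.ofReal_lt_ofReal_iff_of_nonneg (by positivity), abs_inv, inv_mul_eq_div,
        lt_div_iff₀ (abs_pos.2 hBdet0)]
      apply lt_of_pow_lt_pow_left₀ 2 (by positivity)
      rw [mul_pow, sq_abs, hBdet]
      have h6 : (2 * Real.pi * a ^ 3) ^ 2 = 32 * Real.pi ^ 2 * D ^ 3 := by
        calc (2 * Real.pi * a ^ 3) ^ 2 = 4 * Real.pi ^ 2 * (a ^ 2) ^ 3 := by ring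
          _ = _ := by rw [ha2]; ring
      rw [h6]
      have hpi : 9 < Real.pi ^ 2 := by nlinarith [Real.pi_gt_three]
      nlinarith [pow_pos hDR 3]
  obtain ⟨v, hvL, hv0, hvK⟩ := exists_ne_zero_mem_of_index_lt L hL0 (s := B.mulVecLin ⁻¹' K)
    (by
      intro x hx
      simp only [K, Set.mem_preimage, Set.mem_ofPred_eq, map_neg, Pi.neg_apply, abs_neg,
        neg_sq] at hx ⊢
      exact hx)
    ((convex_cylinder a).linear_preimage _) hvol
  refine primitiveZeros_nonempty_of_value_eq_zero hv0 ?_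
  have h1 : |value S v| < 2 * D := by
    have h2 : |((value S v : ℤ) : ℝ)| < 2 * D := by
      rw [hBval, ← ha2]
      obtain ⟨h3, h4⟩ := hvK
      simp only [Matrix.mulVecLin_apply] at h3 h4
      have h5 := sq_lt_sq' (abs_lt.1 h3).1 (abs_lt.1 h3).2
      rw [abs_lt]
      constructor <;> nlinarith [sq_nonneg ((B *ᵥ fun i => (v i : ℝ)) 0),
        sq_nonneg ((B *ᵥ fun i => (v i : ℝ)) 1), sq_nonneg ((B *ᵥ fun i => (v i : ℝ)) 2)]
    exact_mod_cast h2
  exact Int.eq_zero_of_abs_lt_dvd (hLdvd v hvL) (by exact_mod_cast h1)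

end Isotropy

/-! ### From local to global invariants -/

section LocalGlobal

theorem int_dvd_of_forall_padicInt_dvd {a b : ℤ}
    (h : ∀ p : Nat.Primes, (a : ℤ_[(p : ℕ)]) ∣ (b : ℤ_[(p : ℕ)])) : a ∣ b := by
  rw [← Int.natAbs_dvd_natAbs, Nat.dvd_iff_prime_pow_dvd_dvd]
  intro q k hq hk
  rw [← Int.natCast_dvd] at hk ⊢
  have : Fact q.Prime := ⟨hq⟩
  push_cast at hk ⊢
  rw [← PadicInt.pow_p_dvd_int_iff] at hk ⊢
  exact hk.trans (h ⟨q, hq⟩)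

theorem intCast_padicInt_eq_pow_mul_unit (p : ℕ) [Fact p.Prime] {n : ℤ} (hn : n ≠ 0) :
    ∃ ε : ℤ_[p]ˣ, (n : ℤ_[p]) = (p : ℤ_[p]) ^ n.natAbs.factorization p * ε := by
  obtain ⟨k, ε, h⟩ := padicInt_exists_eq_pow_mul_unit (x := (n : ℤ_[p])) (by exact_mod_cast hn)
  have key : ∀ l, l ≤ k ↔ l ≤ n.natAbs.factorization p := fun l => by
    rw [← padicInt_pow_dvd_pow_mul_unit ε, ← h, PadicInt.pow_p_dvd_int_iff,
      ← (Fact.out : p.Prime).pow_dvd_iff_le_factorization (by simpa using hn), ← Int.natCast_dvd]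
    push_cast
    rfl
  obtain rfl : k = n.natAbs.factorization p := le_antisymm ((key k).1 le_rfl) ((key _).2 le_rfl)
  exact ⟨ε, h⟩

theorem int_two_dvd (c : ℤ) : 2 ∣ c ^ 2 - c := by
  have h : c ^ 2 - c = c * (c - 1) := by ring
  rw [h]
  exact (Int.even_mul_pred_self c).two_dvd

/-- The primes give equality up to sign, and the real place, where determinants change by squares,
fixes the sign. -/
theorem SameGenus.det_eq {S S' : Matrix (Fin 3) (Fin 3) ℤ} (h : SameGenus S S')
    (hS : 0 < S.det) : S'.det = S.det := by
  have h1 : Associated S'.det S.det := by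
    refine associated_of_dvd_dvd ?_ ?_ <;> refine int_dvd_of_forall_padicInt_dvd fun p => ?_ <;>
      obtain ⟨ε, hε⟩ := (h.1 p).exists_det_eq <;>
      rw [det_baseChange, det_baseChange] at hε <;> rw [hε, ← Units.val_pow_eq_pow_val]
    · exact Units.mul_left_dvd.2 dvd_rfl
    · exact Units.dvd_mul_left.2 dvd_rfl
  have h2 : 0 < S'.det := by
    obtain ⟨ε, hε⟩ := h.2.exists_det_eq
    rw [det_baseChange, det_baseChange] at hε
    have h3 : (0 : ℝ) < S'.det := by
      rw [hε]
      have : (0 : ℝ) < S.det := by exact_mod_cast hS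
      have := ε.ne_zero
      positivity
    exact_mod_cast h3
  have h4 := Int.associated_iff_natAbs.1 h1
  omega

theorem SameGenus.isSymm {S S' : Matrix (Fin 3) (Fin 3) ℤ} (h : SameGenus S S')
    (hS : S.IsSymm) : S'.IsSymm := by
  have h1 := h.2.isSymm (IsSymm.baseChange hS)
  ext i j
  have h2 := h1.apply j i
  simp only [baseChange, Matrix.map_apply] at h2
  exact_mod_cast h2.symm

theorem SameGenus.of_equivalent_right {S S' S'' : Matrix (Fin 3) (Fin 3) ℤ} (h : SameGenus S S')
    (h' : Equivalent S' S'') : SameGenus S S'' :=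
  ⟨fun p => (h.1 p).trans h'.baseChange, h.2.trans h'.baseChange⟩

theorem SameGenus.refl (S : Matrix (Fin 3) (Fin 3) ℤ) : SameGenus S S :=
  ⟨fun _ => Equivalent.refl _, Equivalent.refl _⟩

end LocalGlobal

/-! ### Special matrices and their corner -/

section Special

variable {S : Matrix (Fin 3) (Fin 3) ℤ}

/-- The exponent of `p` in `Ω`. -/
noncomputable def omegaExp (S : Matrix (Fin 3) (Fin 3) ℤ) (p : ℕ) : ℕ :=
  (minorGcd S).factorization p

/-- The exponent of `p` in `Δ`. -/
noncomputable def deltaExp (S : Matrix (Fin 3) (Fin 3) ℤ) (p : ℕ) : ℕ :=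
  (Delta S).natAbs.factorization p

theorem IsSpecial.det_eq_mul (hS : IsSpecial S) :
    S.det = (minorGcd S : ℤ) ^ 2 * Delta S := by
  rw [det_eq hS.primitive, Omega, neg_sq]

theorem IsSpecial.minorGcd_ne_zero (hS : IsSpecial S) : minorGcd S ≠ 0 := fun h => by
  have h1 := hS.det_pos
  rw [hS.det_eq_mul, h] at h1
  simp at h1

theorem IsSpecial.delta_ne_zero (hS : IsSpecial S) : Delta S ≠ 0 := fun h => by
  have h1 := hS.det_pos
  rw [hS.det_eq_mul, h] at h1
  simp at h1

theorem levelN_eq (S : Matrix (Fin 3) (Fin 3) ℤ) :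
    levelN S = (minorGcd S).gcd (Delta S).natAbs := by
  simp [levelN, Omega, Int.gcd]

theorem IsSpecial.levelN_ne_zero (hS : IsSpecial S) : levelN S ≠ 0 := by
  rw [levelN_eq]
  exact Nat.gcd_ne_zero_left hS.minorGcd_ne_zero

theorem IsSpecial.factorization_levelN (hS : IsSpecial S) (p : ℕ) :
    (levelN S).factorization p = min (omegaExp S p) (deltaExp S p) := by
  rw [levelN_eq, Nat.factorization_gcd hS.minorGcd_ne_zero (by simpa using hS.delta_ne_zero)]
  rfl

theorem IsSpecial.isSpecialType (hS : IsSpecial S) (p : ℕ) :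
    IsSpecialType (omegaExp S p) (deltaExp S p) := by
  have hN := hS.squarefree_N
  have h1 : Squarefree (minorGcd S / levelN S) := by
    have h := Int.squarefree_natAbs.2 hS.squarefree_Omega_div
    rwa [Omega, Int.neg_ediv_of_dvd, Int.natAbs_neg, ← Int.natCast_div, Int.natAbs_natCast] at h
    rw [levelN_eq]
    exact_mod_cast Nat.gcd_dvd_left _ _
  have h2 : Squarefree ((Delta S).natAbs / levelN S) := by
    have h := Int.squarefree_natAbs.2 hS.squarefree_Delta_div
    rwa [Int.natAbs_ediv_of_dvd, Int.natAbs_natCast] at h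
    rw [levelN_eq, Int.natCast_dvd]
    exact Nat.gcd_dvd_right _ _
  have e1 := h1.natFactorization_le_one p
  have e2 := h2.natFactorization_le_one p
  have e3 := hN.natFactorization_le_one p
  rw [Nat.factorization_div (by rw [levelN_eq]; exact Nat.gcd_dvd_left _ _)] at e1
  rw [Nat.factorization_div (by rw [levelN_eq]; exact Nat.gcd_dvd_right _ _)] at e2
  rw [hS.factorization_levelN] at e3
  simp only [Finsupp.coe_tsub, Pi.sub_apply, hS.factorization_levelN] at e1 e2
  exact ⟨e3, e1, e2⟩

theorem IsSpecial.hasType (hS : IsSpecial S) (p : ℕ) [Fact p.Prime] :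
    HasType (omegaExp S p) (deltaExp S p) (baseChange ℤ_[p] S) := by
  have hp : p.Prime := Fact.out
  have hdvd : ∀ (k : ℕ) (n : ℤ), (p : ℤ_[p]) ^ k ∣ (n : ℤ_[p]) ↔ ((p ^ k : ℕ) : ℤ) ∣ n :=
    fun k n => by
      rw [PadicInt.pow_p_dvd_int_iff]
      push_cast
      rfl
  refine ⟨fun h => ?_, fun a b => ?_, fun h => ?_, ?_⟩
  · have h1 := hS.primitive p fun i j => by
      have := (hdvd 1 (S i j)).1 (by rw [pow_one]; exact h i j)
      simpa using this
    exact (Nat.prime_iff_prime_int.1 hp).not_isUnit h1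
  · rw [adjugate_baseChange]
    refine (hdvd _ _).2 (dvd_trans ?_ (minorGcd_dvd S a b))
    exact_mod_cast Nat.ordProj_dvd (minorGcd S) p
  · rw [adjugate_baseChange] at h
    have h1 : p ^ (omegaExp S p + 1) ∣ minorGcd S := by
      refine Finset.dvd_gcd fun ij _ => ?_
      have h2 := (hdvd _ _).1 (h ij.2 ij.1)
      have h3 : S.adjugate ij.2 ij.1 = (-1) ^ (ij.1 + ij.2 : ℕ) * minor S ij.1 ij.2 :=
        Matrix.adjugate_fin_succ_eq_det_submatrix S ij.2 ij.1
      rw [h3, (isUnit_one.neg.pow _).dvd_mul_left] at h2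
      exact Int.natCast_dvd.1 h2
    rw [hp.pow_dvd_iff_le_factorization hS.minorGcd_ne_zero] at h1
    exact absurd h1 (by simp [omegaExp])
  · obtain ⟨ε, hε⟩ := intCast_padicInt_eq_pow_mul_unit p hS.det_pos.ne'
    refine ⟨ε, ?_⟩
    rw [det_baseChange, hε]
    congr 2
    rw [hS.det_eq_mul, Int.natAbs_mul, Int.natAbs_pow, Int.natAbs_natCast,
      Nat.factorization_mul (pow_ne_zero _ hS.minorGcd_ne_zero) (by simpa using hS.delta_ne_zero),
      Nat.factorization_pow]
    rfl

/-- Both conditions are divisibilities in `ℤ`, the second being `gcd(r', s') ∣ t'`, and so can be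
checked in every `ℤ_[p]`, where `S'` is equivalent to `S`. -/
theorem IsSpecial.isRigid_of_sameGenus (hS : IsSpecial S) {r : ℤ}
    (hr : ∀ p : Nat.Primes,
      Associated ((p : ℤ_[(p : ℕ)]) ^ cornerExp (omegaExp S p) (deltaExp S p)) (r : ℤ_[(p : ℕ)]))
    {S' : Matrix (Fin 3) (Fin 3) ℤ} (h : SameGenus S S') : IsRigid S' r := by
  intro r' s' t' u' h'
  have hloc : ∀ p : Nat.Primes, Associated (r : ℤ_[(p : ℕ)]) (r' : ℤ_[(p : ℕ)]) ∧
      ∃ a b, (t' : ℤ_[(p : ℕ)]) = a * (r' : ℤ_[(p : ℕ)]) + b * (s' : ℤ_[(p : ℕ)]) := by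
    intro p
    refine (hS.hasType p).isRigid (hS.isSpecialType p) (hr p) _ _ _ u' ?_
    rw [← baseChange_flagForm]
    exact (h.1 p).trans h'.baseChange
  refine ⟨associated_of_dvd_dvd (int_dvd_of_forall_padicInt_dvd fun p => (hloc p).1.dvd)
    (int_dvd_of_forall_padicInt_dvd fun p => (hloc p).1.symm.dvd), ?_⟩
  have hg : (Int.gcd r' s' : ℤ) ∣ t' := by
    refine int_dvd_of_forall_padicInt_dvd fun p => ?_
    obtain ⟨a, b, hab⟩ := (hloc p).2
    rw [hab]
    exact dvd_add (Dvd.dvd.mul_left (map_dvd (Int.castRingHom ℤ_[(p : ℕ)]) (Int.gcd_dvd_left ..)) _)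
      (Dvd.dvd.mul_left (map_dvd (Int.castRingHom ℤ_[(p : ℕ)]) (Int.gcd_dvd_right ..)) _)
  obtain ⟨d, hd⟩ := hg
  exact ⟨Int.gcdA r' s' * d, Int.gcdB r' s' * d, by rw [hd, Int.gcd_eq_gcd_ab]; ring⟩

/-- `flagForm r s 0 u`, with `r > 0`, is a Gram matrix of the special matrix `S` of odd
determinant. -/
structure IsCorner (S : Matrix (Fin 3) (Fin 3) ℤ) (r : ℕ) (s u : ℤ) : Prop where
  pos : 0 < r
  det : (r : ℤ) ^ 2 * s = -S.det
  odd : Odd ((r : ℤ) * s)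
  equivalent : Equivalent S (flagForm (r : ℤ) s 0 u)
  exponent : ∀ p : Nat.Primes, r.factorization p = cornerExp (omegaExp S p) (deltaExp S p)
  rigid : ∀ S', SameGenus S S' → IsRigid S' (r : ℤ)

theorem IsSpecial.exists_isCorner (hS : IsSpecial S) (hD : Odd S.det) :
    ∃ r s u, IsCorner S r s u := by
  obtain ⟨x, hx⟩ := hS.isotropic
  obtain ⟨r, s, t, u, hdet, hframe⟩ := exists_framedBy_flagForm hS.symm hx
  have hne : r ^ 2 * s ≠ 0 := by
    rw [hdet]
    exact neg_ne_zero.2 hS.det_pos.ne'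
  have hr0 : r ≠ 0 := by rintro rfl; simp at hne
  have hassoc : ∀ p : Nat.Primes,
      Associated ((p : ℤ_[(p : ℕ)]) ^ cornerExp (omegaExp S p) (deltaExp S p))
        (r : ℤ_[(p : ℕ)]) := by
    intro p
    have h1 := hframe.equivalent.baseChange (R := ℤ_[(p : ℕ)])
    rw [baseChange_flagForm] at h1
    obtain ⟨σ, ε, η, hr, -, -⟩ :=
      ((hS.hasType p).of_equivalent h1).flagForm_exponents (hS.isSpecialType p)
    exact ⟨ε, hr.symm⟩
  have hexp : ∀ p : Nat.Primes,
      r.natAbs.factorization p = cornerExp (omegaExp S p) (deltaExp S p) := by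
    intro p
    obtain ⟨ε, hε⟩ := intCast_padicInt_eq_pow_mul_unit p hr0
    obtain ⟨η, hη⟩ := hassoc p
    apply le_antisymm
    · rw [← padicInt_pow_dvd_pow_mul_unit η, hη, hε]
      exact dvd_mul_right _ _
    · rw [← padicInt_pow_dvd_pow_mul_unit ε, ← hε, ← hη]
      exact dvd_mul_right _ _
  have hrabs : Associated r (r.natAbs : ℤ) := by
    rw [Int.associated_iff_natAbs, Int.natAbs_natCast]
  have hrig : ∀ S', SameGenus S S' → IsRigid S' (r.natAbs : ℤ) := fun S' hS' =>
    hS.isRigid_of_sameGenus (fun p => (hassoc p).trans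
      (hrabs.map (Int.castRingHom ℤ_[(p : ℕ)]))) hS'
  have hdet' : (r.natAbs : ℤ) ^ 2 * s = -S.det := by rw [Int.natAbs_sq, hdet]
  obtain ⟨u', hu'⟩ := (hrig S (SameGenus.refl S)).exists_framedBy hS.symm (by simpa using hr0)
    hdet' hx
  have hodd : Odd ((r.natAbs : ℤ) ^ 2 * s) := hdet' ▸ hD.neg
  rw [Int.odd_mul] at hodd
  exact ⟨r.natAbs, s, u', Int.natAbs_pos.2 hr0, hdet',
    Int.odd_mul.2 ⟨(Int.odd_pow' two_ne_zero).1 hodd.1, hodd.2⟩, hu'.equivalent, hexp, hrig⟩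

end Special

/-! ### Counting residues by genus and by class -/

section Counting

variable {S : Matrix (Fin 3) (Fin 3) ℤ} {r : ℕ} {s u : ℤ}

/-- The residues modulo `p ^ v_p(r)` of the `p`-adic integers `v` such that `flagForm r s 0 v` is
equivalent to `S`. -/
abbrev LocalResidues (S : Matrix (Fin 3) (Fin 3) ℤ) (r : ℕ) (s : ℤ) (p : ℕ) [Fact p.Prime] : Type :=
  {q : ZMod (p ^ r.factorization p) // ∃ v, PadicInt.toZModPow (r.factorization p) v = q ∧
    Equivalent (baseChange ℤ_[p] S) (flagForm (r : ℤ_[p]) (s : ℤ_[p]) 0 v)}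

/-- The residues modulo `r` of the integers `v` such that `flagForm r s 0 v` is equivalent to
`S`. -/
abbrev ClassResidues (S : Matrix (Fin 3) (Fin 3) ℤ) (r : ℕ) (s : ℤ) : Type :=
  {q : ZMod r // ∃ v : ℤ, (v : ZMod r) = q ∧ Equivalent S (flagForm (r : ℤ) s 0 v)}

/-- The residues modulo `r` of the integers `v` such that `flagForm r s 0 v` is in the genus of
`S`. -/
abbrev GenusResidues (S : Matrix (Fin 3) (Fin 3) ℤ) (r : ℕ) (s : ℤ) : Type :=
  {q : ZMod r // ∃ v : ℤ, (v : ZMod r) = q ∧ SameGenus S (flagForm (r : ℤ) s 0 v)}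

namespace IsCorner

theorem s_ne_zero (h : IsCorner S r s u) : s ≠ 0 := by
  rintro rfl
  simpa using h.odd

theorem exists_padic_odd (h : IsCorner S r s u) (p : ℕ) [Fact p.Prime] :
    ∃ q : ℤ_[p], (r : ℤ_[p]) * (s : ℤ_[p]) = 2 * q + 1 := by
  obtain ⟨q, hq⟩ := h.odd
  exact ⟨q, by exact_mod_cast congrArg (Int.cast : ℤ → ℤ_[p]) hq⟩

theorem padic_dvd_iff (h : IsCorner S r s u) (p : ℕ) [Fact p.Prime] (x : ℤ_[p]) :
    (r : ℤ_[p]) ∣ x ↔ (p : ℤ_[p]) ^ r.factorization p ∣ x := by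
  obtain ⟨ε, hε⟩ := intCast_padicInt_eq_pow_mul_unit p (n := r) (by exact_mod_cast h.pos.ne')
  rw [Int.cast_natCast, Int.natAbs_natCast] at hε
  rw [hε, Units.mul_right_dvd]

theorem padic_equivalent (h : IsCorner S r s u) (p : ℕ) [Fact p.Prime] :
    Equivalent (baseChange ℤ_[p] S) (flagForm (r : ℤ_[p]) (s : ℤ_[p]) 0 (u : ℤ_[p])) := by
  have h1 := h.equivalent.baseChange (R := ℤ_[p])
  rw [baseChange_flagForm] at h1
  simpa using h1

theorem nonempty_local_equiv (h : IsCorner S r s u) (hS : IsSpecial S) (p : Nat.Primes) :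
    Nonempty (ZeroOrbits (baseChange ℤ_[(p : ℕ)] S) ≃ LocalResidues S r s p) := by
  have hr0 : (r : ℤ_[(p : ℕ)]) ≠ 0 := by exact_mod_cast h.pos.ne'
  refine nonempty_zeroOrbits_equiv padicInt_two_dvd_sq_sub hr0
    (by exact_mod_cast h.s_ne_zero) (h.exists_padic_odd p) _
    (fun v v' => (toZModPow_eq_iff _ v v').trans (h.padic_dvd_iff p _).symm) fun x hx => ?_
  refine IsRigid.exists_framedBy ?_ (IsSymm.baseChange hS.symm) hr0 ?_ hx
  · refine (hS.hasType p).isRigid (hS.isSpecialType p) (associated_of_dvd_dvd ?_ ?_)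
    · rw [← h.exponent, ← h.padic_dvd_iff]
    · rw [h.padic_dvd_iff, h.exponent]
  · rw [det_baseChange]
    exact_mod_cast congrArg (Int.cast : ℤ → ℤ_[(p : ℕ)]) h.det

theorem card_localResidues (h : IsCorner S r s u) (hS : IsSpecial S) (hD : Odd S.det)
    (p : Nat.Primes) : Nat.card (LocalResidues S r s p) =
      if (p : ℕ) ∣ levelN S then ((p : ℕ) - 1) / 2 else 1 := by
  have hp : (p : ℕ).Prime := p.2
  have h1 := (hS.hasType p).card_corner_residues (hS.isSpecialType p) (h.exists_padic_odd p)
    (h.padic_equivalent p) (fun hi h2 => by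
      have h3 : (p : ℕ) ∣ minorGcd S := Nat.dvd_of_factorization_pos hi
      have h4 : (2 : ℤ) ∣ S.det := by
        rw [hS.det_eq_mul]
        exact Dvd.dvd.mul_right (dvd_pow (by rw [h2] at h3; exact_mod_cast h3) two_ne_zero) _
      exact (Int.not_even_iff_odd.2 hD) (even_iff_two_dvd.2 h4))
  rw [← h.exponent] at h1
  refine h1.trans ?_
  congr 1
  rw [hp.dvd_iff_one_le_factorization hS.levelN_ne_zero, hS.factorization_levelN]
  simp only [eq_iff_iff]
  omega

theorem finite_localResidues (p : ℕ) [Fact p.Prime] : Finite (LocalResidues S r s p) := by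
  have : NeZero (p ^ r.factorization p) := ⟨pow_ne_zero _ (Fact.out : p.Prime).ne_zero⟩
  infer_instance

theorem localOrbitCount_eq (h : IsCorner S r s u) (hS : IsSpecial S) (p : Nat.Primes) :
    localOrbitCount S p = Nat.card (LocalResidues S r s p) :=
  Nat.card_congr (h.nonempty_local_equiv hS p).some

theorem nonempty_class_equiv (h : IsCorner S r s u) (hS : IsSpecial S)
    {S' : Matrix (Fin 3) (Fin 3) ℤ} (hS' : SameGenus S S') :
    Nonempty (ZeroOrbits S' ≃ ClassResidues S' r s) := by
  have hr0 : (r : ℤ) ≠ 0 := by exact_mod_cast h.pos.ne'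
  refine nonempty_zeroOrbits_equiv int_two_dvd hr0 h.s_ne_zero h.odd _
    (fun v v' => ZMod.intCast_eq_intCast_iff_dvd_sub _ _ _) fun x hx => ?_
  exact (h.rigid S' hS').exists_framedBy (hS'.isSymm hS.symm) hr0
    (by rw [hS'.det_eq hS.det_pos, h.det]) hx

theorem real_equivalent (h : IsCorner S r s u) (hS : IsSpecial S) (v : ℤ) :
    Equivalent (baseChange ℝ S) (baseChange ℝ (flagForm (r : ℤ) s 0 v)) := by
  obtain ⟨A, hA⟩ := h.equivalent.baseChange (R := ℝ)
  refine real_equivalent_of_det_eq (IsSymm.baseChange hS.symm) (IsSymm.baseChange ?_) ?_ ?_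
    ⟨_, mem_zeros hA (x := ![1, 0, 0]) ?_⟩ ⟨![1, 0, 0], ?_⟩
  · ext i j
    fin_cases i <;> fin_cases j <;> simp [flagForm]
  · rw [det_baseChange]
    exact_mod_cast hS.det_pos.ne'
  · rw [det_baseChange, det_baseChange, det_flagForm, h.det, neg_neg]
  · rw [baseChange_flagForm]
    exact flagForm_zero_mem _ _ _ _
  · rw [baseChange_flagForm]
    exact flagForm_zero_mem _ _ _ _

theorem padic_equivalent_flagForm (h : IsCorner S r s u) (p : ℕ) [Fact p.Prime] {v v' : ℤ_[p]}
    (hv : Equivalent (baseChange ℤ_[p] S) (flagForm (r : ℤ_[p]) (s : ℤ_[p]) 0 v))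
    (hvv' : (p : ℤ_[p]) ^ r.factorization p ∣ v' - v) :
    Equivalent (baseChange ℤ_[p] S) (flagForm (r : ℤ_[p]) (s : ℤ_[p]) 0 v') :=
  hv.trans (flagForm_framedBy_of_dvd padicInt_two_dvd_sq_sub (h.exists_padic_odd p)
    ((h.padic_dvd_iff p _).2 hvv')).equivalent

/-- At a prime not dividing `r` the modulus is 1 and every `v` is admissible; at the real place both
forms are isotropic of the same determinant. Only the primes dividing `r` impose conditions, one on
each component of `ZMod.equivPi`. -/
theorem sameGenus_iff (h : IsCorner S r s u) (hS : IsSpecial S) (q : ZMod r) :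
    (∃ v : ℤ, (v : ZMod r) = q ∧ SameGenus S (flagForm (r : ℤ) s 0 v)) ↔
      ∀ p : r.primeFactors,
        haveI : Fact (p : ℕ).Prime := ⟨Nat.prime_of_mem_primeFactors p.2⟩
        ∃ v, PadicInt.toZModPow (r.factorization p) v = ZMod.equivPi r h.pos.ne' q p ∧
          Equivalent (baseChange ℤ_[(p : ℕ)] S)
            (flagForm (r : ℤ_[(p : ℕ)]) (s : ℤ_[(p : ℕ)]) 0 v) := by
  constructor
  · rintro ⟨v, rfl, hv⟩ p
    have hp : (p : ℕ).Prime := Nat.prime_of_mem_primeFactors p.2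
    have : Fact (p : ℕ).Prime := ⟨hp⟩
    refine ⟨v, by simp, ?_⟩
    have h1 := hv.1 ⟨p, hp⟩
    rw [baseChange_flagForm] at h1
    simpa using h1
  · intro hq
    obtain ⟨v, rfl⟩ := ZMod.intCast_surjective q
    refine ⟨v, rfl, fun p => ?_, h.real_equivalent hS v⟩
    rw [baseChange_flagForm, Int.cast_zero, Int.cast_natCast]
    by_cases hp : (p : ℕ) ∈ r.primeFactors
    · obtain ⟨w, hw, hw'⟩ := hq ⟨p, hp⟩
      refine h.padic_equivalent_flagForm p hw' ?_
      rw [← toZModPow_eq_iff, hw]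
      simp
    · refine h.padic_equivalent_flagForm p (h.padic_equivalent p) ?_
      rw [Finsupp.notMem_support_iff.1 (by rwa [Nat.support_factorization])]
      simp

theorem localOrbitCount_eq_one_of_notMem (h : IsCorner S r s u) (hS : IsSpecial S)
    {p : Nat.Primes} (hp : (p : ℕ) ∉ r.primeFactors) : localOrbitCount S p = 1 := by
  rw [h.localOrbitCount_eq hS, Nat.card_eq_one_iff_unique]
  refine ⟨?_, ⟨⟨_, u, rfl, h.padic_equivalent p⟩⟩⟩
  have : Subsingleton (ZMod ((p : ℕ) ^ r.factorization p)) := by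
    rw [Finsupp.notMem_support_iff.1 (by rwa [Nat.support_factorization]), pow_zero]
    infer_instance
  infer_instance

theorem card_genusResidues (h : IsCorner S r s u) (hS : IsSpecial S) :
    Nat.card (GenusResidues S r s) = ∏ᶠ p : Nat.Primes, localOrbitCount S p := by
  let f : r.primeFactors ↪ Nat.Primes :=
    ⟨fun p => ⟨p, Nat.prime_of_mem_primeFactors p.2⟩, fun p q hpq =>
      Subtype.ext (congrArg (fun l : Nat.Primes => (l : ℕ)) hpq)⟩
  rw [finprod_eq_prod_of_mulSupport_subset (s := Finset.univ.map f), Finset.prod_map]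
  · calc Nat.card (GenusResidues S r s) = Nat.card (∀ p, LocalResidues S r s (f p)) :=
        Nat.card_congr ((Equiv.subtypeEquiv (ZMod.equivPi r h.pos.ne').toEquiv
          (h.sameGenus_iff hS)).trans (Equiv.subtypePiEquivPi
            (p := fun p : r.primeFactors => fun q : ZMod ((p : ℕ) ^ r.factorization p) =>
              ∃ v, PadicInt.toZModPow (p := f p) (r.factorization p) v = q ∧
                Equivalent (baseChange ℤ_[(f p : ℕ)] S)
                  (flagForm (r : ℤ_[(f p : ℕ)]) (s : ℤ_[(f p : ℕ)]) 0 v))))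
      _ = ∏ p, Nat.card (LocalResidues S r s (f p)) := Nat.card_pi
      _ = _ := Finset.prod_congr rfl fun p _ => (h.localOrbitCount_eq hS (f p)).symm
  · intro p hp
    have : (p : ℕ) ∈ r.primeFactors := by
      by_contra hp'
      exact hp (h.localOrbitCount_eq_one_of_notMem hS hp')
    exact Finset.mem_coe.2 (Finset.mem_map.2 ⟨⟨p, this⟩, Finset.mem_univ _, rfl⟩)

/-- Isotropy of `S'` enters here; it makes `toClass` surjective and the genus finite. -/
theorem exists_classResidue (h : IsCorner S r s u) (hS : IsSpecial S)
    {S' : Matrix (Fin 3) (Fin 3) ℤ} (hS' : SameGenus S S') : Nonempty (ClassResidues S' r s) := by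
  have hdet := h.det
  have hpos := hS.det_pos
  have hiso : IsIsotropic S' := by
    refine isIsotropic_of_locally_equivalent (r := r) (s := s) (u := u) (hS'.isSymm hS.symm)
      (by omega) ?_ ?_ (fun p => h.equivalent.symm.baseChange.trans (hS'.1 p))
      (hS'.2.symm.trans h.equivalent.baseChange)
    · have := Int.odd_mul.1 h.odd
      exact this.1.pow.mul this.2
    · rw [hS'.det_eq hpos]
      omega
  obtain ⟨x, hx⟩ := hiso
  exact ⟨(h.nonempty_class_equiv hS hS').some (Quotient.mk _ ⟨x, hx⟩)⟩

/-- The class of the forms `flagForm r s 0 v` with `v` in a given residue class. -/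
noncomputable def toClass (S : Matrix (Fin 3) (Fin 3) ℤ) (r : ℕ) (s : ℤ)
    (q : GenusResidues S r s) : GenusClasses S :=
  Quotient.mk (classSetoid S) ⟨flagForm (r : ℤ) s 0 q.2.choose, q.2.choose_spec.2⟩

/-- The representative chosen in `toClass` is immaterial, since the residue modulo `r` determines
the form up to equivalence. -/
theorem toClass_eq_iff (h : IsCorner S r s u) (S' : genus S) (q : GenusResidues S r s) :
    toClass S r s q = Quotient.mk (classSetoid S) S' ↔
      ∃ v : ℤ, (v : ZMod r) = q ∧ Equivalent S'.1 (flagForm (r : ℤ) s 0 v) := by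
  have hq := q.2.choose_spec
  constructor
  · intro h1
    exact ⟨_, hq.1, Equivalent.symm (Quotient.exact h1)⟩
  · rintro ⟨v, hv, hv'⟩
    refine Quotient.sound (Equivalent.symm (hv'.trans ?_))
    refine (flagForm_framedBy_of_dvd int_two_dvd h.odd ?_).equivalent
    rw [← ZMod.intCast_eq_intCast_iff_dvd_sub _ _ r, hv, hq.1]

theorem toClass_surjective (h : IsCorner S r s u) (hS : IsSpecial S) :
    Function.Surjective (toClass S r s) := by
  rintro ⟨S'⟩
  obtain ⟨q, v, hv, hv'⟩ := h.exists_classResidue hS S'.2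
  exact ⟨⟨q, v, hv, SameGenus.of_equivalent_right S'.2 hv'⟩,
    (h.toClass_eq_iff S' _).2 ⟨v, hv, hv'⟩⟩

theorem finite_genusClasses (h : IsCorner S r s u) (hS : IsSpecial S) :
    Finite (GenusClasses S) := by
  have : NeZero r := ⟨h.pos.ne'⟩
  exact Finite.of_surjective _ (h.toClass_surjective hS)

/-- The residues attached to the orbits of `S'` are exactly the fibre of `toClass` over its class,
so summing over classes counts `GenusResidues`. -/
theorem classOrbitCount_eq (h : IsCorner S r s u) (hS : IsSpecial S) (C : GenusClasses S) :
    classOrbitCount C = Nat.card {q // toClass S r s q = C} := by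
  obtain ⟨S', rfl⟩ := Quotient.exists_rep C
  change Nat.card (ZeroOrbits S'.1) = _
  rw [Nat.card_congr (h.nonempty_class_equiv hS S'.2).some]
  symm
  refine Nat.card_congr ((Equiv.subtypeSubtypeEquivSubtypeExists _ _).trans
    (Equiv.subtypeEquivRight fun q => ?_))
  constructor
  · rintro ⟨hq, hq'⟩
    exact (h.toClass_eq_iff S' _).1 hq'
  · rintro ⟨v, hv, hv'⟩
    exact ⟨⟨v, hv, SameGenus.of_equivalent_right S'.2 hv'⟩,
      (h.toClass_eq_iff S' _).2 ⟨v, hv, hv'⟩⟩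

theorem finsum_classOrbitCount (h : IsCorner S r s u) (hS : IsSpecial S) :
    ∑ᶠ C : GenusClasses S, classOrbitCount C = Nat.card (GenusResidues S r s) := by
  have : NeZero r := ⟨h.pos.ne'⟩
  have := h.finite_genusClasses hS
  have := Fintype.ofFinite (GenusClasses S)
  rw [finsum_eq_sum_of_fintype, ← Nat.card_congr (Equiv.sigmaFiberEquiv (toClass S r s)),
    Nat.card_sigma]
  exact Finset.sum_congr rfl fun C _ => h.classOrbitCount_eq hS C

end IsCorner

theorem orbitCount_real_eq_one {S : Matrix (Fin 3) (Fin 3) ℝ} (hS : S.IsSymm) (hdet : S.det ≠ 0)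
    (hne : (primitiveZeros S).Nonempty) : orbitCount S = 1 := by
  obtain ⟨x, hx⟩ := hne
  refine Nat.card_eq_one_iff_unique.2 ⟨⟨?_⟩, ⟨Quotient.mk _ ⟨x, hx⟩⟩⟩
  rintro ⟨y⟩ ⟨z⟩
  exact Quotient.sound
    ((real_exists_framedBy hS hdet y.2).exists_automorph (real_exists_framedBy hS hdet z.2))

theorem IsSpecial.finprod_localOrbitCount (hS : IsSpecial S) (hD : Odd S.det)
    (hloc : ∀ p : Nat.Primes, localOrbitCount S p =
      if (p : ℕ) ∣ levelN S then ((p : ℕ) - 1) / 2 else 1) :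
    ((∏ᶠ p : Nat.Primes, localOrbitCount S p : ℕ) : ℚ) =
      ∏ p ∈ (levelN S).primeFactors, ((p : ℚ) - 1) / 2 := by
  let f : (levelN S).primeFactors ↪ Nat.Primes :=
    ⟨fun p => ⟨p, Nat.prime_of_mem_primeFactors p.2⟩, fun p q hpq =>
      Subtype.ext (congrArg (fun l : Nat.Primes => (l : ℕ)) hpq)⟩
  rw [finprod_eq_prod_of_mulSupport_subset (s := Finset.univ.map f), Finset.prod_map,
    Nat.cast_prod, ← Finset.prod_coe_sort (levelN S).primeFactors]
  · refine Finset.prod_congr rfl fun p _ => ?_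
    have hp : (p : ℕ).Prime := Nat.prime_of_mem_primeFactors p.2
    have hpN : (p : ℕ) ∣ levelN S := Nat.dvd_of_mem_primeFactors p.2
    -- Oddness of `p` makes the natural-number quotient `(p - 1) / 2` exact, so it agrees with the
    -- rational one.
    have hp2 : (p : ℕ) ≠ 2 := fun h2 => by
      have h4 : (2 : ℤ) ∣ S.det := by
        rw [hS.det_eq_mul]
        refine Dvd.dvd.mul_right (dvd_pow ?_ two_ne_zero) _
        rw [h2, levelN_eq] at hpN
        exact_mod_cast hpN.trans (Nat.gcd_dvd_left _ _)
      exact (Int.not_even_iff_odd.2 hD) (even_iff_two_dvd.2 h4)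
    rw [hloc]
    change ((if (p : ℕ) ∣ levelN S then ((p : ℕ) - 1) / 2 else 1 : ℕ) : ℚ) = _
    rw [if_pos hpN, Nat.cast_div (hp.even_sub_one hp2).two_dvd (by norm_num),
      Nat.cast_sub hp.one_le]
    simp
  · intro p hp
    have : (p : ℕ) ∣ levelN S := by
      by_contra hp'
      exact hp (by rw [hloc, if_neg hp'])
    exact Finset.mem_coe.2 (Finset.mem_map.2
      ⟨⟨p, Nat.mem_primeFactors.2 ⟨p.2, this, hS.levelN_ne_zero⟩⟩, Finset.mem_univ _, rfl⟩)

theorem IsSpecial.finite_localOrbitCount_ne_one (hS : IsSpecial S)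
    (hloc : ∀ p : Nat.Primes, localOrbitCount S p =
      if (p : ℕ) ∣ levelN S then ((p : ℕ) - 1) / 2 else 1) :
    {p : Nat.Primes | localOrbitCount S p ≠ 1}.Finite := by
  refine Set.Finite.of_finite_image (f := fun p : Nat.Primes => (p : ℕ))
    ((levelN S).primeFactors.finite_toSet.subset ?_) Subtype.val_injective.injOn
  rintro _ ⟨p, hp, rfl⟩
  have : (p : ℕ) ∣ levelN S := by
    by_contra hp'
    exact hp (by rw [hloc, if_neg hp'])
  exact Nat.mem_primeFactors.2 ⟨p.2, this, hS.levelN_ne_zero⟩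

end Counting

end TernaryForm

theorem theorem1 (S : Matrix (Fin 3) (Fin 3) ℤ) (hS : TernaryForm.IsSpecial S)
    (hD : Odd S.det) :
    Finite (TernaryForm.GenusClasses S) ∧
    (∀ S' ∈ TernaryForm.genus S, Finite (TernaryForm.ZeroOrbits S')) ∧
    (∀ p : Nat.Primes,
      Finite (TernaryForm.ZeroOrbits (TernaryForm.baseChange ℤ_[(p : ℕ)] S))) ∧
    {p : Nat.Primes | TernaryForm.localOrbitCount S p ≠ 1}.Finite ∧
    TernaryForm.orbitCount (TernaryForm.baseChange ℝ S) = 1 ∧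
    ∑ᶠ C : TernaryForm.GenusClasses S, TernaryForm.classOrbitCount C =
      ∏ᶠ p : Nat.Primes, TernaryForm.localOrbitCount S p ∧
    ((∑ᶠ C : TernaryForm.GenusClasses S, TernaryForm.classOrbitCount C : ℕ) : ℚ) =
      ∏ p ∈ (TernaryForm.levelN S).primeFactors, ((p : ℚ) - 1) / 2 := by
  obtain ⟨r, s, u, h⟩ := hS.exists_isCorner hD
  have : NeZero r := ⟨h.pos.ne'⟩
  have hloc := fun p => (h.localOrbitCount_eq hS p).trans (h.card_localResidues hS hD p)
  have hsum := (h.finsum_classOrbitCount hS).trans (h.card_genusResidues hS)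
  refine ⟨h.finite_genusClasses hS,
    fun S' hS' => Finite.of_equiv _ (h.nonempty_class_equiv hS hS').some.symm,
    fun p => ?_, hS.finite_localOrbitCount_ne_one hloc, ?_, hsum, ?_⟩
  · have := TernaryForm.IsCorner.finite_localResidues (S := S) (r := r) (s := s) p
    exact Finite.of_equiv _ (h.nonempty_local_equiv hS p).some.symm
  · obtain ⟨A, hA⟩ := h.equivalent.baseChange (R := ℝ)
    refine TernaryForm.orbitCount_real_eq_one (TernaryForm.IsSymm.baseChange hS.symm) ?_
      ⟨_, TernaryForm.mem_zeros hA (x := ![1, 0, 0]) ?_⟩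
    · rw [TernaryForm.det_baseChange]
      exact_mod_cast hS.det_pos.ne'
    · rw [TernaryForm.baseChange_flagForm]
      exact TernaryForm.flagForm_zero_mem _ _ _ _
  · rw [hsum]
    exact hS.finprod_localOrbitCount hD hloc
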